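/- Let $0<\gamma<1$, and let $F_N$ ($N\in\mathbb N$) be a sequence of complex unit-norm equiangular tight frames, $F_N$ (written as an $m_N\times n_N$ matrix) consisting of $n_N$ vectors in $\mathbb C^{m_N}$, with $n_N\to\infty$ and aspect ratios $\gamma_N=m_N/n_N\to\gamma$ (in particular, the aspect ratio may be constantly $\gamma$). Put $x=\gamma^{-1}-1$, $s=(1-x)/(2\sqrt x)$, and let $A_1=s$, $A_2=1$, $A_{l+1}=-\sum_{i=1}^{l}A_iA_{l+1-i}$ for $l\ge 2$. For a frame $F$ of $n$ vectors in $\mathbb C^m$, with $\gamma_F=m/n$ and $x_F=\gamma_F^{-1}-1$, the generalized conference matrix is $$S=\sqrt{\tfrac{n-1}{x_F}}\Bigl(F^*F-\tfrac1{2\gamma_F}I_n\Bigr).$$ For $k\ge1$ and a partition $\pi$ of $[k]=\{1,\dots,k\}$, let $$V_n(\pi)=\frac1{n^{k/2+1}}\sum_{a}S_{a(1),a(2)}S_{a(2),a(3)}\cdots S_{a(k),a(1)},$$ the sum being over the maps $a:[k]\to[n]$ whose set of non-empty fibres is $\pi$. Let $G_\pi$ be the multigraph whose vertices are the blocks of $\pi$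 and which has, for each $i\in[k]$, one edge joining the block of $i$ to the block of $i+1$ (with $k+1$ read as $1$); a loop is a simple cycle of length $1$ and a pair of parallel edges is a simple cycle of length $2$. (1) For every $k\ge1$ and every non-crossing partition $\pi$ of $[k]$: if the edges of $G_\pi$ partition into simple cycles of lengths $l_1,\dots,l_r$, then, along the sequence $F_N$, $$V_{n_N}(\pi)\longrightarrow A_{l_1}\cdots A_{l_r}\qquad(N\to\infty).$$ (2) Let $p\in[0,1]$ and let $P$ be the random diagonal $n\times n$ matrix whose diagonal entries are independent Bernoulli($p$) variables. For every $k\ge1$, along the sequence $F_N$, $$\frac1{n^{k/2+1}}\,E\operatorname{tr}\bigl((PSP)^k\bigr)\longrightarrow M_k:=\sum_{\pi}p^{|\pi|}\prod_{C}A_{|C|},$$ where $\pi$ runs over the non-crossing partitions of $[k]$, $|\pi|$ is the number of blocks of $\pi$, $C$ runs over the simple cycles of $G_\pi$ and $|C|$ is the length of $C$; and $$\frac1n\,E\operatorname{tr}\bigl((PF^*FP)^k\bigr)\longrightarrow\Bigl(\frac{x+1}2\Bigr)^k p+\sum_{j=1}^{k}\binom kj x^{j/2}\Bigl(\frac{x+1}2\Bigr)^{k-j}M_j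 .$$ -/

import Mathlib

open Filter Topology
open scoped Matrix

noncomputable section

namespace ETF

/-- The columns of `F` form an equiangular tight frame of `n` unit vectors in `ℂ^m`. -/
structure IsUnitNormETF {m n : ℕ} (F : Matrix (Fin m) (Fin n) ℂ) : Prop where
  unit_norm : ∀ j, ∑ i, ‖F i j‖ ^ 2 = 1
  tight : ∃ a : ℝ, 0 < a ∧ F * Fᴴ = (a : ℂ) • (1 : Matrix (Fin m) (Fin m) ℂ)
  equiangular : ∃ c : ℝ, ∀ i j, i ≠ j → ‖(Fᴴ * F) i j‖ = c

/-- The parameter `x = γ⁻¹ - 1` of an aspect ratio `γ`. -/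
def ratioParam (γ : ℝ) : ℝ := γ⁻¹ - 1

/-- The parameter `s = (1 - x) / (2 √x)` of an aspect ratio `γ`, with `x = γ⁻¹ - 1`. -/
def diagParam (γ : ℝ) : ℝ := (1 - ratioParam γ) / (2 * √(ratioParam γ))

/-- The aspect ratio `m / n` of a frame of `n` vectors in `ℂ^m`. -/
def aspectRatio (m n : ℕ) : ℝ := (m : ℝ) / (n : ℝ)

/-- The generalized conference matrix `S = √((n - 1) / x) • (F' F - (1 / (2 γ)) I)`, where
`γ = m / n` and `x = γ⁻¹ - 1`. -/
def conferenceMatrix {m n : ℕ} (F : Matrix (Fin m) (Fin n) ℂ) : Matrix (Fin n) (Fin n) ℂ :=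
  ((√(((n : ℝ) - 1) / ratioParam (aspectRatio m n)) : ℝ) : ℂ) •
    (Fᴴ * F - ((1 / (2 * aspectRatio m n) : ℝ) : ℂ) • (1 : Matrix (Fin n) (Fin n) ℂ))

/-- A set partition of `[k]`; the points of `[k]` are in cyclic order, the successor of `i`
being `finRotate k i`. -/
abbrev SetPartition (k : ℕ) : Type := Finpartition (Finset.univ : Finset (Fin k))

/-- `π` is non-crossing: there are no `a < b < c < d` with `a, c` in one block and `b, d` in
another one. -/
def IsNonCrossing {k : ℕ} (π : SetPartition k) : Prop :=
  ∀ a b c d : Fin k, a < b → b < c → c < d →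
    π.part a = π.part c → π.part b = π.part d → π.part a = π.part b

/-- `L_n(π)`: the maps `a : [k] → [n]` whose fibres are exactly the blocks of `π`. -/
def labelings {k : ℕ} (n : ℕ) (π : SetPartition k) : Finset (Fin k → Fin n) :=
  {a | Finset.univ.image (fun i => ({j | a j = a i} : Finset (Fin k))) = π.parts}

/-- The normalized cyclic sum
`V_n(π) = n ^ (-(k / 2 + 1)) ∑_{a ∈ L_n(π)} S_{a(1),a(2)} S_{a(2),a(3)} ⋯ S_{a(k),a(1)}`. -/
def cyclicSum {n k : ℕ} (S : Matrix (Fin n) (Fin n) ℂ) (π : SetPartition k) : ℂ :=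
  ((1 / (n : ℝ) ^ ((k : ℝ) / 2 + 1) : ℝ) : ℂ) *
    ∑ a ∈ labelings n π, ∏ i, S (a i) (a (finRotate k i))

/-- The multigraph `G_π`: its vertices are the blocks of `π`, and it has one edge for each
`i ∈ [k]`, joining the block of `i` to the block of the cyclic successor of `i`. -/
def partitionGraph {k : ℕ} (π : SetPartition k) : Graph (Finset (Fin k)) (Fin k) where
  vertexSet := {B | B ∈ π.parts}
  IsLink i B B' := s(B, B') = s(π.part i, π.part (finRotate k i))
  isLink_symm := fun _ _ => ⟨fun _ _ h => by rw [Sym2.eq_swap]; exact h⟩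
  eq_or_eq_of_isLink_of_isLink := by
    intro e x y v w h h'
    have h2 := h.trans h'.symm
    rw [Sym2.eq_iff] at h2
    rcases h2 with ⟨h, -⟩ | ⟨h, -⟩
    · exact Or.inl h
    · exact Or.inr h
  left_mem_of_isLink := by
    intro e x y h
    rw [Sym2.eq_iff] at h
    rcases h with ⟨rfl, -⟩ | ⟨rfl, -⟩
    · exact π.part_mem.2 (Finset.mem_univ _)
    · exact π.part_mem.2 (Finset.mem_univ _)

/-- `C` is the edge set of a simple cycle of the multigraph `G`: for some `l ≥ 1` there are
distinct vertices `v_1, …, v_l` and distinct edges `e_1, …, e_l` such that `e_r` joins `v_r` to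
`v_{r+1}` (indices modulo `l`) and `C = {e_1, …, e_l}`. A loop is a simple cycle of length one and
two parallel edges form a simple cycle of length two. -/
def IsSimpleCycle {α β : Type*} (G : Graph α β) (C : Finset β) : Prop :=
  ∃ (l : ℕ) (v : Fin l → α) (e : Fin l → β), 0 < l ∧ Function.Injective v ∧
    Function.Injective e ∧ (∀ r, G.IsLink (e r) (v r) (v (finRotate l r))) ∧
    (C : Set β) = Set.range e

open Classical in
/-- The (edge sets of the) simple cycles of `G_π`. For non-crossing `π` the graph is a cactus,
so these are pairwise disjoint. -/
def simpleCycles {k : ℕ} (π : SetPartition k) : Finset (Finset (Fin k)) :=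
  {C | IsSimpleCycle (partitionGraph π) C}

/-- The numbers `A_l`: `A_1 = s`, `A_2 = 1` and `A_{l+1} = -∑_{i=1}^{l} A_i A_{l+1-i}` for `l ≥ 2`.
The value at `l = 0` is never used. -/
def cycleWeight (s : ℝ) : ℕ → ℝ
  | 0 => 0
  | 1 => s
  | 2 => 1
  | l + 3 => -∑ i : Fin (l + 2), cycleWeight s (i + 1) * cycleWeight s (l + 2 - i)

/-- The recursion in its usual form. -/
theorem cycleWeight_succ (s : ℝ) {l : ℕ} (hl : 2 ≤ l) :
    cycleWeight s (l + 1) =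
      -∑ i ∈ Finset.Icc 1 l, cycleWeight s i * cycleWeight s (l + 1 - i) := by
  obtain ⟨l, rfl⟩ := Nat.exists_eq_add_of_le' hl
  rw [cycleWeight, Fin.sum_univ_eq_sum_range
    (fun i => cycleWeight s (i + 1) * cycleWeight s (l + 2 - i)) (l + 2)]
  congr 1
  refine Finset.sum_bij (fun i _ => i + 1) ?_ ?_ ?_ ?_
  · intro i hi
    simp only [Finset.mem_range] at hi
    simp only [Finset.mem_Icc]
    omega
  · intro i _ j _ h
    omega
  · intro i hi
    simp only [Finset.mem_Icc] at hi
    exact ⟨i - 1, by simp only [Finset.mem_range]; omega, by omega⟩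
  · intro i _
    have h : l + 2 + 1 - (i + 1) = l + 2 - i := by omega
    rw [h]

/-- The 0-1 diagonal matrix `P` that selects the indices in `T`. -/
def selection {n : ℕ} (T : Finset (Fin n)) : Matrix (Fin n) (Fin n) ℂ :=
  Matrix.diagonal fun i => if i ∈ T then 1 else 0

/-- The expectation of `f T`, where the random set `T ⊆ [n]` contains each index independently
with probability `p`. -/
def bernoulliExpect (n : ℕ) (p : ℝ) (f : Finset (Fin n) → ℂ) : ℂ :=
  ∑ T : Finset (Fin n), ((p ^ T.card * (1 - p) ^ (n - T.card) : ℝ) : ℂ) * f T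

/-- `m^S_k = n ^ (-(k / 2 + 1)) E trace ((P S P) ^ k)`, the diagonal entries of `P` being
independent Bernoulli(`p`) variables. -/
def conferenceMoment {n : ℕ} (S : Matrix (Fin n) (Fin n) ℂ) (p : ℝ) (k : ℕ) : ℂ :=
  ((1 / (n : ℝ) ^ ((k : ℝ) / 2 + 1) : ℝ) : ℂ) *
    bernoulliExpect n p fun T => ((selection T * S * selection T) ^ k).trace

/-- `m_k = E (1 / n) trace ((P F' F P) ^ k)`, the `k`-th moment of a Bernoulli(`p`)-selected
subset of the frame `F`. -/
def frameMoment {m n : ℕ} (F : Matrix (Fin m) (Fin n) ℂ) (p : ℝ) (k : ℕ) : ℂ :=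
  bernoulliExpect n p fun T =>
    (1 / (n : ℂ)) * ((selection T * (Fᴴ * F) * selection T) ^ k).trace

open Classical in
/-- The limit of `m^S_k`: the sum, over the non-crossing partitions `π` of `[k]`, of
`p ^ t ∏ A_l`, where `t` is the number of blocks of `π` and `l` runs over the lengths of the
simple cycles of `G_π`. -/
def limitConferenceMoment (s p : ℝ) (k : ℕ) : ℝ :=
  ∑ π : SetPartition k with IsNonCrossing π,
    p ^ π.parts.card * ∏ C ∈ simpleCycles π, cycleWeight s C.card

/-- The limit of `m_k`, for `k ≥ 1`, in terms of the limits of the `m^S_j`. -/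
def limitFrameMoment (γ p : ℝ) (k : ℕ) : ℝ :=
  ((ratioParam γ + 1) / 2) ^ k * p +
    ∑ j ∈ Finset.Icc 1 k, (k.choose j : ℝ) * √(ratioParam γ) ^ j *
      ((ratioParam γ + 1) / 2) ^ (k - j) * limitConferenceMoment (diagParam γ) p j

end ETF

end

/-!
The generalized conference matrix divided by `√n` is Hermitian, its diagonal is constant and
tends to `s`, its off-diagonal entries have modulus `1 / √n`, and its square is a multiple of the
identity (`IsUnitNormETF.isScaledConference`); the cyclic sums need nothing else. A cyclic sum
over a partition `π` is a sum over the injective labelings of the vertices of a digraph, whose edges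
form a closed walk through the blocks of `π` (`graphSum`, `cyclicSum_eq_graphSum`). Such a sum obeys
the following rules. A loop contributes a factor tending to `s`. Summing over the label of a vertex
`v` with one incoming and one outgoing edge gives a factor tending to `1` if both of its neighbours
are the same vertex (`graphSum_pendant`); if they differ, then, since the square of the matrix is
diagonal, it gives minus the sum of the contributions in which `v` is identified with one of the
other vertices (`graphSum_merge`). A loopless walk which visits all its vertices, with the possible
exception of its start, at least twice contributes `O(n ^ (-1 / 2))` (`norm_graphSum_le`).

None of these reductions destroys a crossing, so crossing partitions do not contribute to the limit
(`tendsto_graphSum_of_crossing`). In a noncrossing closed walk, a shortest closed piece is a cycle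
`F` which meets the remaining walk in one vertex only. Identifying the first new vertex of `F` with
another vertex either splits `F` into cycles of lengths `i` and `l - i`, or creates a crossing; so
the contributions satisfy the recursion of the numbers `A_l`, and `F` contributes the factor `A_l`
(`tendsto_graphSum_insert_cycle`). As the new vertices of `F` have degree two, `F` is the only simple
cycle which contains an edge of `F`, so that removing such cycles one by one lists all the simple
cycles of the graph (`exists_cycles_of_not_crossing`). The moments of the compressed conference
matrix are linear combinations of the cyclic sums over all partitions (`conferenceMoment_eq_sum`),
and those of the compressed Gram matrix follow by binomial expansion (`frameMoment_eq`).
-/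

namespace ETF

/-! ### Injective sums over digraphs -/

/-- The sum, over the maps `a : α → Fin n` that are injective on the vertex set `σ`, of
`∏ S (a (src e)) (a (tgt e))` over the edges `e` of the digraph with edge list `E`. The maps are
averaged over their values off `σ`, so that only the restriction of `a` to `σ` matters, and the
total is divided by `n`. -/
noncomputable def graphSum {α β : Type*} [Fintype α] [DecidableEq α] {n : ℕ}
    (S : Matrix (Fin n) (Fin n) ℂ) (src tgt : β → α) (σ : Finset α) (E : List β) : ℂ :=
  open Classical in
  (n : ℂ) ^ σ.card / n / (n : ℂ) ^ Fintype.card α *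
    ∑ a : α → Fin n, if Set.InjOn a σ then (E.map fun e => S (a (src e)) (a (tgt e))).prod else 0

/-- What is used of the generalized conference matrix divided by `√n`: its diagonal entries are all
equal to `d`, its off-diagonal entries have modulus `1 / √n` and, as it is Hermitian, opposite
ones have product `1 / n`, and its square is diagonal. -/
structure IsScaledConference {n : ℕ} (S : Matrix (Fin n) (Fin n) ℂ) (d : ℂ) : Prop where
  diag : ∀ i, S i i = d
  mul_swap : ∀ i j, i ≠ j → S i j * S j i = 1 / n
  norm_sq : ∀ i j, i ≠ j → ‖S i j‖ ^ 2 = 1 / n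
  sum_mul : ∀ i j, i ≠ j → ∑ l, S i l * S l j = 0

/-- Resampling the value of `a` at `v` only multiplies the sum by `n`. -/
theorem sum_sum_update {α : Type*} [Fintype α] [DecidableEq α] {n : ℕ} (v : α)
    (h : (α → Fin n) → ℂ) :
    ∑ a : α → Fin n, ∑ j, h (Function.update a v j) = n * ∑ a, h a := by
  let φ : ((α → Fin n) × Fin n) ≃ ((α → Fin n) × Fin n) :=
    { toFun := fun q => (Function.update q.1 v q.2, q.1 v)
      invFun := fun q => (Function.update q.1 v q.2, q.1 v)
      left_inv := fun q => by simp
      right_inv := fun q => by simp }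
  calc ∑ a : α → Fin n, ∑ j, h (Function.update a v j)
      = ∑ q : (α → Fin n) × Fin n, h (φ q).1 := by rw [Fintype.sum_prod_type]; rfl
    _ = ∑ q : (α → Fin n) × Fin n, h q.1 := φ.sum_comp (fun q => h q.1)
    _ = n * ∑ a, h a := by
      rw [Fintype.sum_prod_type]; simp [Finset.mul_sum]

section

variable {α β : Type*} [Fintype α] [DecidableEq α] {n : ℕ} {S : Matrix (Fin n) (Fin n) ℂ}
  {src tgt : β → α} {σ : Finset α} {E : List β}

theorem graphSum_perm {E' : List β} (h : E.Perm E') :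
    graphSum S src tgt σ E = graphSum S src tgt σ E' := by
  unfold graphSum
  congr 1
  refine Finset.sum_congr rfl fun a _ => ?_
  rw [(h.map _).prod_eq]

theorem graphSum_congr {src' tgt' : β → α} (h : ∀ e ∈ E, src e = src' e ∧ tgt e = tgt' e) :
    graphSum S src tgt σ E = graphSum S src' tgt' σ E := by
  unfold graphSum
  congr 1
  refine Finset.sum_congr rfl fun a _ => ?_
  rw [List.map_congr_left fun e he => by rw [(h e he).1, (h e he).2]]

theorem graphSum_singleton_nil (hn : 0 < n) (x : α) : graphSum S src tgt {x} [] = 1 := by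
  have : (n : ℂ) ≠ 0 := by exact_mod_cast hn.ne'
  unfold graphSum
  simp [this]

theorem graphSum_loop {d : ℂ} (hS : IsScaledConference S d) {e : β} (he : src e = tgt e) :
    graphSum S src tgt σ (e :: E) = d * graphSum S src tgt σ E := by
  unfold graphSum
  rw [mul_left_comm, Finset.mul_sum _ _ d]
  congr 1
  refine Finset.sum_congr rfl fun a _ => ?_
  split_ifs <;> simp [he, hS.diag]

/-- Summation over the label `j` of a vertex `v` of degree two, on the path `src e → v → tgt e'`. -/
theorem graphSum_insert (hn : 0 < n) {v : α} (hv : v ∉ σ) {e e' : β} (he : tgt e = v)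
    (he' : src e' = v) (hu : src e ∈ σ) (hw : tgt e' ∈ σ)
    (hE : ∀ f ∈ E, src f ≠ v ∧ tgt f ≠ v) :
    open Classical in
    graphSum S src tgt (insert v σ) (e :: e' :: E) =
      (n : ℂ) ^ σ.card / n / (n : ℂ) ^ Fintype.card α *
      ∑ a : α → Fin n, if Set.InjOn a σ then
        (E.map fun f => S (a (src f)) (a (tgt f))).prod *
          ∑ j ∈ (σ.image a)ᶜ, S (a (src e)) j * S j (a (tgt e')) else 0 := by
  classical
  have hn' : (n : ℂ) ≠ 0 := by exact_mod_cast hn.ne'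
  unfold graphSum
  set h : (α → Fin n) → ℂ := fun a => if Set.InjOn a ((insert v σ : Finset α) : Set α) then
    ((e :: e' :: E).map fun e => S (a (src e)) (a (tgt e))).prod else 0 with hh
  have key := sum_sum_update v h
  have h1 : ∑ a, h a = (n : ℂ)⁻¹ * ∑ a : α → Fin n, ∑ j, h (Function.update a v j) := by
    rw [key]; field_simp
  rw [Finset.card_insert_of_notMem hv, h1, ← mul_assoc]
  congr 1
  · field_simp
    ring
  refine Finset.sum_congr rfl fun a _ => ?_
  have hupd : ∀ j, ∀ y ∈ σ, Function.update a v j y = a y := fun j y hy =>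
    Function.update_of_ne (ne_of_mem_of_not_mem hy hv) _ _
  have hinj : ∀ j, Set.InjOn (Function.update a v j) ((insert v σ : Finset α) : Set α) ↔
      Set.InjOn a σ ∧ j ∈ (σ.image a)ᶜ := by
    intro j
    rw [Finset.coe_insert, Set.injOn_insert (by simpa using hv)]
    have h2 : Set.EqOn (Function.update a v j) a σ := fun y hy => hupd j y hy
    rw [h2.injOn_iff, h2.image_eq]
    simp
  by_cases ha : Set.InjOn a σ
  · rw [if_pos ha, Finset.mul_sum, ← Finset.sum_filter_add_sum_filter_not Finset.univ
      (fun j => j ∈ (σ.image a)ᶜ)]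
    rw [Finset.sum_eq_zero (s := Finset.univ.filter fun j => j ∉ (σ.image a)ᶜ)
      (fun j hj => by
        have hj' := (Finset.mem_filter.1 hj).2
        simp only [hh]
        rw [if_neg (fun hc => hj' ((hinj j).1 hc).2)]), add_zero]
    rw [Finset.filter_mem_eq_inter, Finset.univ_inter]
    refine Finset.sum_congr rfl fun j hj => ?_
    simp only [hh]
    rw [if_pos ((hinj j).2 ⟨ha, hj⟩)]
    have h3 : (E.map fun f => S (Function.update a v j (src f)) (Function.update a v j (tgt f))) =
        E.map fun f => S (a (src f)) (a (tgt f)) :=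
      List.map_congr_left fun f hf => by
        rw [Function.update_of_ne (hE f hf).1, Function.update_of_ne (hE f hf).2]
    rw [List.map_cons, List.map_cons, List.prod_cons, List.prod_cons, h3, he, he',
      hupd j _ hu, hupd j _ hw, Function.update_self]
    ring
  · rw [if_neg ha]
    refine Finset.sum_eq_zero fun j _ => ?_
    simp only [hh]
    rw [if_neg (fun hc => ha ((hinj j).1 hc).1)]

/-- A vertex joined to the rest of the graph by a pair of antiparallel edges only. -/
theorem graphSum_pendant {d : ℂ} (hS : IsScaledConference S d) (hn : 0 < n) {v : α}
    (hv : v ∉ σ) {e e' : β} (he : tgt e = v) (he' : src e' = v) (hu : src e ∈ σ)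
    (hw : tgt e' = src e) (hE : ∀ f ∈ E, src f ≠ v ∧ tgt f ≠ v) :
    graphSum S src tgt (insert v σ) (e :: e' :: E) =
      (n - σ.card) / n * graphSum S src tgt σ E := by
  classical
  rw [graphSum_insert hn hv he he' hu (hw ▸ hu) hE]
  unfold graphSum
  rw [mul_left_comm ((n - σ.card : ℂ) / n), Finset.mul_sum _ _ ((n - σ.card : ℂ) / n)]
  congr 1
  refine Finset.sum_congr rfl fun a _ => ?_
  split_ifs with ha
  · rw [mul_comm]
    congr 1
    rw [Finset.sum_congr rfl (g := fun _ => (1 / n : ℂ))]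
    · rw [Finset.sum_const, Finset.card_compl, Fintype.card_fin, nsmul_eq_mul, Nat.cast_sub,
        Finset.card_image_of_injOn ha]
      · ring
      · exact (Finset.card_le_univ _).trans_eq (Fintype.card_fin n)
    · intro j hj
      rw [hw]
      refine hS.mul_swap _ _ fun h => ?_
      rw [Finset.mem_compl] at hj
      exact hj (h ▸ Finset.mem_image_of_mem a hu)
  · simp

/-- The sum over all labels of a vertex `v` of degree two with distinct neighbours vanishes, because
the square of `S` is diagonal; hence the sum over the labels different from those of the other
vertices is minus the sum of the contributions in which `v` is identified with one of them. -/
theorem graphSum_merge {d : ℂ} (hS : IsScaledConference S d) (hn : 0 < n) {v : α}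
    (hv : v ∉ σ) {e e' : β} (he : tgt e = v) (he' : src e' = v) (hu : src e ∈ σ)
    (hw : tgt e' ∈ σ) (huw : src e ≠ tgt e') (hE : ∀ f ∈ E, src f ≠ v ∧ tgt f ≠ v) :
    graphSum S src tgt (insert v σ) (e :: e' :: E) =
      -∑ z ∈ σ, graphSum S (Function.update id v z ∘ src) (Function.update id v z ∘ tgt) σ
        (e :: e' :: E) := by
  classical
  rw [graphSum_insert hn hv he he' hu hw hE]
  unfold graphSum
  rw [← Finset.mul_sum, Finset.sum_comm, ← mul_neg, ← Finset.sum_neg_distrib]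
  congr 1
  refine Finset.sum_congr rfl fun a _ => ?_
  split_ifs with ha
  · have h0 : ∑ j ∈ (σ.image a)ᶜ, S (a (src e)) j * S j (a (tgt e')) =
        -∑ z ∈ σ, S (a (src e)) (a z) * S (a z) (a (tgt e')) := by
      have h1 := hS.sum_mul (a (src e)) (a (tgt e')) (fun h => huw (ha hu hw h))
      rw [← Finset.sum_compl_add_sum (σ.image a), Finset.sum_image ha] at h1
      exact eq_neg_of_add_eq_zero_left h1
    rw [h0, mul_neg, Finset.mul_sum]
    congr 1
    refine Finset.sum_congr rfl fun z _ => ?_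
    have h3 : (E.map fun f => S (a ((Function.update id v z ∘ src) f))
        (a ((Function.update id v z ∘ tgt) f))) = E.map fun f => S (a (src f)) (a (tgt f)) :=
      List.map_congr_left fun f hf => by
        simp only [Function.comp_apply]
        rw [Function.update_of_ne (hE f hf).1, Function.update_of_ne (hE f hf).2]
        rfl
    rw [List.map_cons, List.map_cons, List.prod_cons, List.prod_cons, h3]
    simp only [Function.comp_apply, he, he', Function.update_self]
    rw [Function.update_of_ne (ne_of_mem_of_not_mem hu hv),
      Function.update_of_ne (ne_of_mem_of_not_mem hw hv)]
    simp only [id]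
    ring
  · simp

/-- A loopless digraph with few vertices compared to its edges: each of the `n ^ |σ|` labelings
contributes at most `n ^ (-|E| / 2)`. -/
theorem norm_graphSum_le {d : ℂ} (hS : IsScaledConference S d) (hn : 0 < n)
    (hE : ∀ e ∈ E, src e ≠ tgt e) (hsrc : ∀ e ∈ E, src e ∈ σ) (htgt : ∀ e ∈ E, tgt e ∈ σ)
    (hcard : 2 * σ.card ≤ E.length + 1) :
    ‖graphSum S src tgt σ E‖ ≤ 1 / √n := by
  classical
  have hn' : (0 : ℝ) < n := by exact_mod_cast hn
  have hs : 0 < √(n : ℝ) := Real.sqrt_pos.2 hn'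
  have hs1 : 1 ≤ √(n : ℝ) := Real.one_le_sqrt.2 (by exact_mod_cast hn)
  have hb : ∀ a : α → Fin n, ‖(if Set.InjOn a σ then
      (E.map fun e => S (a (src e)) (a (tgt e))).prod else 0 : ℂ)‖ ≤ (1 / √n) ^ E.length := by
    intro a
    split_ifs with ha
    · have hent : ∀ e ∈ E, ‖S (a (src e)) (a (tgt e))‖ = 1 / √n := fun e he => by
        have h1 := hS.norm_sq (a (src e)) (a (tgt e))
          (fun h => hE e he (ha (hsrc e he) (htgt e he) h))
        rw [← Real.sqrt_sq (norm_nonneg (S _ _)), h1, Real.sqrt_div zero_le_one, Real.sqrt_one]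
      clear hE hsrc htgt hcard ha
      induction E with
      | nil => simp
      | cons e E ih =>
        rw [List.map_cons, List.prod_cons, norm_mul, List.length_cons, pow_succ',
          hent e (by simp)]
        exact mul_le_mul_of_nonneg_left (ih fun f hf => hent f (by simp [hf])) (by positivity)
    · simp
  unfold graphSum
  rw [norm_mul]
  have hsum := (norm_sum_le Finset.univ _).trans (Finset.sum_le_sum fun a _ => hb a)
  rw [Finset.sum_const, nsmul_eq_mul, Finset.card_univ, Fintype.card_fun, Fintype.card_fin] at hsum
  refine (mul_le_mul_of_nonneg_left hsum (norm_nonneg _)).trans ?_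
  simp only [norm_div, norm_pow, Complex.norm_natCast]
  push_cast
  have e1 : (n : ℝ) ^ σ.card / n / (n : ℝ) ^ Fintype.card α *
      ((n : ℝ) ^ Fintype.card α * (1 / √n) ^ E.length) = √n ^ (2 * σ.card) / √n ^ (E.length + 2) := by
    rw [pow_mul, pow_add _ E.length, Real.sq_sqrt hn'.le, one_div, inv_pow]
    field_simp
  rw [e1, div_le_div_iff₀ (by positivity) hs, one_mul, ← pow_succ]
  exact pow_le_pow_right₀ hs1 (by omega)

end

/-- The matrices `S N` are scaled conference matrices of growing size whose diagonal entries tend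
to `s`. -/
structure IsScaledConferenceSeq {n : ℕ → ℕ} (S : ∀ N, Matrix (Fin (n N)) (Fin (n N)) ℂ)
    (s : ℝ) : Prop where
  size : Tendsto n atTop atTop
  exists_diag : ∃ d : ℕ → ℂ, Tendsto d atTop (𝓝 (s : ℂ)) ∧
    ∀ᶠ N in atTop, IsScaledConference (S N) (d N)

/-! ### Limits of digraph sums -/

section Limits

variable {α β : Type*} [Fintype α] [DecidableEq α] {n : ℕ → ℕ}
  {S : ∀ N, Matrix (Fin (n N)) (Fin (n N)) ℂ} {s : ℝ} {src tgt : β → α} {σ : Finset α}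
  {E : List β} {L : ℂ}

theorem tendsto_graphSum_nil (hS : IsScaledConferenceSeq S s) (x : α) :
    Tendsto (fun N => graphSum (S N) src tgt {x} []) atTop (𝓝 1) := by
  refine tendsto_const_nhds.congr' ?_
  filter_upwards [hS.size.eventually_gt_atTop 0] with N hN
  exact (graphSum_singleton_nil hN x).symm

theorem tendsto_graphSum_loop (hS : IsScaledConferenceSeq S s) {e : β} (he : src e = tgt e)
    (h : Tendsto (fun N => graphSum (S N) src tgt σ E) atTop (𝓝 L)) :
    Tendsto (fun N => graphSum (S N) src tgt σ (e :: E)) atTop (𝓝 (s * L)) := by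
  obtain ⟨d, hd, hSd⟩ := hS.exists_diag
  refine (hd.mul h).congr' ?_
  filter_upwards [hSd] with N hN
  exact (graphSum_loop hN he).symm

theorem tendsto_graphSum_pendant (hS : IsScaledConferenceSeq S s) {v : α}
    (hv : v ∉ σ) {e e' : β} (he : tgt e = v) (he' : src e' = v) (hu : src e ∈ σ)
    (hw : tgt e' = src e) (hE : ∀ f ∈ E, src f ≠ v ∧ tgt f ≠ v)
    (h : Tendsto (fun N => graphSum (S N) src tgt σ E) atTop (𝓝 L)) :
    Tendsto (fun N => graphSum (S N) src tgt (insert v σ) (e :: e' :: E)) atTop (𝓝 L) := by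
  obtain ⟨d, hd, hSd⟩ := hS.exists_diag
  have h1 : Tendsto (fun N => (σ.card : ℂ) / (n N : ℂ)) atTop (𝓝 0) :=
    (tendsto_const_div_atTop_nhds_zero_nat (𝕜 := ℂ) (σ.card : ℂ)).comp hS.size
  have h2 := ((tendsto_const_nhds (x := (1 : ℂ))).sub h1).mul h
  rw [sub_zero, one_mul] at h2
  refine h2.congr' ?_
  filter_upwards [hSd, hS.size.eventually_gt_atTop 0] with N hN hpos
  have : (n N : ℂ) ≠ 0 := by exact_mod_cast hpos.ne'
  rw [graphSum_pendant hN hpos hv he he' hu hw hE, sub_div, div_self this]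

theorem tendsto_graphSum_merge (hS : IsScaledConferenceSeq S s) {v : α}
    (hv : v ∉ σ) {e e' : β} (he : tgt e = v) (he' : src e' = v) (hu : src e ∈ σ)
    (hw : tgt e' ∈ σ) (huw : src e ≠ tgt e') (hE : ∀ f ∈ E, src f ≠ v ∧ tgt f ≠ v) {M : α → ℂ}
    (h : ∀ z ∈ σ, Tendsto (fun N => graphSum (S N) (Function.update id v z ∘ src)
      (Function.update id v z ∘ tgt) σ (e :: e' :: E)) atTop (𝓝 (M z))) :
    Tendsto (fun N => graphSum (S N) src tgt (insert v σ) (e :: e' :: E)) atTop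
      (𝓝 (-∑ z ∈ σ, M z)) := by
  obtain ⟨d, hd, hSd⟩ := hS.exists_diag
  refine (tendsto_finsetSum _ h).neg.congr' ?_
  filter_upwards [hSd, hS.size.eventually_gt_atTop 0] with N hN hpos
  exact (graphSum_merge hN hpos hv he he' hu hw huw hE).symm

theorem tendsto_graphSum_zero (hS : IsScaledConferenceSeq S s)
    (hE : ∀ e ∈ E, src e ≠ tgt e) (hsrc : ∀ e ∈ E, src e ∈ σ) (htgt : ∀ e ∈ E, tgt e ∈ σ)
    (hcard : 2 * σ.card ≤ E.length + 1) :
    Tendsto (fun N => graphSum (S N) src tgt σ E) atTop (𝓝 0) := by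
  obtain ⟨d, hd, hSd⟩ := hS.exists_diag
  have h1 : Tendsto (fun N => 1 / √(n N : ℝ)) atTop (𝓝 0) := by
    simp only [one_div]
    exact (Real.tendsto_sqrt_atTop.comp
      (tendsto_natCast_atTop_atTop.comp hS.size)).inv_tendsto_atTop
  refine squeeze_zero_norm' ?_ h1
  filter_upwards [hSd, hS.size.eventually_gt_atTop 0] with N hN hpos
  exact norm_graphSum_le hN hpos hE hsrc htgt hcard

end Limits

/-! ### Walks and crossing words -/

section Walks

variable {α β : Type*}

/-- The list of edges `E` is a directed walk from `x` to `y`. -/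
def IsWalk (src tgt : β → α) : α → List β → α → Prop
  | x, [], y => x = y
  | x, e :: E, y => src e = x ∧ IsWalk src tgt (tgt e) E y

/-- The successive vertices of the walk `E` starting at `x`, the start included. -/
def walkWord (tgt : β → α) (x : α) (E : List β) : List α := x :: E.map tgt

variable {src tgt : β → α} {x y z : α} {E E' : List β} {e : β}

@[simp] theorem isWalk_nil : IsWalk src tgt x [] y ↔ x = y := Iff.rfl

@[simp] theorem isWalk_cons :
    IsWalk src tgt x (e :: E) y ↔ src e = x ∧ IsWalk src tgt (tgt e) E y := Iff.rfl

theorem isWalk_append :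
    IsWalk src tgt x (E ++ E') y ↔ ∃ z, IsWalk src tgt x E z ∧ IsWalk src tgt z E' y := by
  induction E generalizing x with
  | nil => simp
  | cons e E ih => simp [ih, and_assoc]

theorem IsWalk.map {γ : Type*} (h : α → γ) (hE : IsWalk src tgt x E y) :
    IsWalk (h ∘ src) (h ∘ tgt) (h x) E (h y) := by
  induction E generalizing x with
  | nil => rw [isWalk_nil] at hE ⊢; rw [hE]
  | cons e E ih =>
    rw [isWalk_cons] at hE ⊢
    exact ⟨congrArg h hE.1, ih hE.2⟩

theorem IsWalk.congr {src' tgt' : β → α} (hE : IsWalk src tgt x E y)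
    (h : ∀ e ∈ E, src e = src' e ∧ tgt e = tgt' e) : IsWalk src' tgt' x E y := by
  induction E generalizing x with
  | nil => exact hE
  | cons e E ih =>
    rw [isWalk_cons] at hE ⊢
    have h1 := h e (by simp)
    exact ⟨h1.1 ▸ hE.1, h1.2 ▸ ih hE.2 fun f hf => h f (by simp [hf])⟩

theorem walkWord_map {γ : Type*} (h : α → γ) :
    walkWord (h ∘ tgt) (h x) E = (walkWord tgt x E).map h := by
  simp [walkWord]

theorem walkWord_append : walkWord tgt x (E ++ E') = walkWord tgt x E ++ E'.map tgt := by
  simp [walkWord]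

theorem IsWalk.exists_walkWord_eq (hE : IsWalk src tgt x E y) :
    ∃ p, walkWord tgt x E = p ++ [y] := by
  induction E generalizing x with
  | nil => exact ⟨[], by rw [isWalk_nil] at hE; simp [walkWord, hE]⟩
  | cons e E ih =>
    obtain ⟨p, hp⟩ := ih hE.2
    exact ⟨x :: p, by simpa [walkWord] using hp⟩

theorem IsWalk.end_mem (hE : IsWalk src tgt x E y) : y ∈ walkWord tgt x E := by
  obtain ⟨p, hp⟩ := hE.exists_walkWord_eq
  simp [hp]

theorem IsWalk.end_mem_map (hE : IsWalk src tgt x E y) (h0 : E ≠ []) : y ∈ E.map tgt := by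
  cases E with
  | nil => exact absurd rfl h0
  | cons e E => exact IsWalk.end_mem (x := tgt e) hE.2

theorem start_mem : x ∈ walkWord tgt x E := by simp [walkWord]

theorem tgt_mem (he : e ∈ E) : tgt e ∈ walkWord tgt x E := by
  simp only [walkWord, List.mem_cons, List.mem_map]
  exact Or.inr ⟨e, he, rfl⟩

theorem IsWalk.src_mem (hE : IsWalk src tgt x E y) (he : e ∈ E) : src e ∈ walkWord tgt x E := by
  induction E generalizing x with
  | nil => simp at he
  | cons f E ih =>
    rcases List.mem_cons.1 he with rfl | he
    · rw [hE.1]; exact start_mem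
    · exact List.mem_cons_of_mem _ (ih hE.2 he)

theorem map_update_of_notMem [DecidableEq α] {l : List α} {v z : α} (hl : v ∉ l) :
    l.map (Function.update id v z) = l := by
  conv_rhs => rw [← List.map_id l]
  exact List.map_congr_left fun y hy => Function.update_of_ne (ne_of_mem_of_not_mem hy hl) _ _

theorem toFinset_map_update [DecidableEq α] {l : List α} {v z : α} {σ : Finset α} (hv : v ∉ σ)
    (hz : z ∈ σ) (hl : l.toFinset = insert v σ) :
    (l.map (Function.update id v z)).toFinset = σ := by
  have himg : (insert v σ).image (Function.update id v z) = σ := by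
    rw [Finset.image_insert, Function.update_self,
      Finset.image_congr (g := id) (fun y hy =>
        Function.update_of_ne (ne_of_mem_of_not_mem hy hv) _ _), Finset.image_id,
      Finset.insert_eq_self.2 hz]
  rw [← himg, ← hl]
  ext
  simp

/-- A word crosses if it contains the pattern `a b a b`, with `a ≠ b`. -/
def Crossing (w : List α) : Prop := ∃ a b, a ≠ b ∧ [a, b, a, b].Sublist w

theorem Crossing.of_sublist {w w' : List α} (h : Crossing w) (hw : w.Sublist w') : Crossing w' := by
  obtain ⟨a, b, hab, hs⟩ := h
  exact ⟨a, b, hab, hs.trans hw⟩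

/-- Consecutive letters of a crossing pattern differ, so merging two equal adjacent letters
preserves crossings. -/
theorem Crossing.dedup {p q : List α} {t : α} (h : Crossing (p ++ t :: t :: q)) :
    Crossing (p ++ t :: q) := by
  obtain ⟨a, b, hab, hs⟩ := h
  refine ⟨a, b, hab, ?_⟩
  obtain ⟨r, r', hr, h1, h2⟩ := List.sublist_append_iff.1 hs
  rw [hr]
  refine h1.append ?_
  rcases List.sublist_cons_iff.1 h2 with h2 | ⟨r1, rfl, h3⟩
  · exact h2
  rcases List.sublist_cons_iff.1 h3 with h3 | ⟨r2, rfl, h3⟩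
  · exact h3.cons_cons t
  exfalso
  rcases r with _ | ⟨_, _ | ⟨_, _ | ⟨_, _ | ⟨_, _⟩⟩⟩⟩ <;> simp at hr <;> grind

/-- The letters of a crossing pattern occur at least twice, so replacing a letter `v` which occurs
only once preserves crossings. -/
theorem Crossing.map [DecidableEq α] {w : List α} {v z : α} (h : Crossing w)
    (hv : w.count v ≤ 1) : Crossing (w.map (Function.update id v z)) := by
  obtain ⟨a, b, hab, hs⟩ := h
  have ha : a ≠ v := by
    rintro rfl
    have h1 := hs.count_le a
    have h2 : 2 ≤ List.count a [a, b, a, b] := by simp [hab.symm]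
    omega
  have hb : b ≠ v := by
    rintro rfl
    have h1 := hs.count_le b
    have h2 : 2 ≤ List.count b [a, b, a, b] := by simp [hab]
    omega
  refine ⟨a, b, hab, ?_⟩
  have h1 := hs.map (Function.update id v z)
  simpa [Function.update_of_ne ha, Function.update_of_ne hb] using h1

end Walks

/-! ### Crossing walks -/

section Crossing

variable {α β : Type*} [Fintype α] [DecidableEq α] {n : ℕ → ℕ}
  {S : ∀ N, Matrix (Fin (n N)) (Fin (n N)) ℂ} {s : ℝ}

/-- The contribution of a crossing closed walk vanishes in the limit. Loops and pendant pairs of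
edges are removed and other vertices of degree two are identified with the remaining vertices, none
of which destroys a crossing; a loopless walk which visits every vertex at least twice has too few
vertices to contribute. -/
theorem tendsto_graphSum_of_crossing (hS : IsScaledConferenceSeq S s) (src tgt : β → α) (x : α)
    (E : List β) (hE : IsWalk src tgt x E x) (hc : Crossing (walkWord tgt x E)) :
    Tendsto (fun N => graphSum (S N) src tgt (walkWord tgt x E).toFinset E) atTop (𝓝 0) := by
  induction hm : E.length + (walkWord tgt x E).toFinset.card using Nat.strong_induction_on
    generalizing src tgt E with
  | _ m ih =>
  subst hm
  by_cases hloop : ∃ e ∈ E, src e = tgt e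
  · obtain ⟨e, he, hst⟩ := hloop
    obtain ⟨l1, l2, rfl⟩ := List.append_of_mem he
    obtain ⟨u, hl1, hu, hl2⟩ := isWalk_append.1 hE
    obtain ⟨p, hp⟩ := hl1.exists_walkWord_eq
    rw [hst] at hu
    subst hu
    have hw : walkWord tgt x (l1 ++ e :: l2) = p ++ tgt e :: tgt e :: l2.map tgt := by
      rw [walkWord_append, hp]; simp
    have hw' : walkWord tgt x (l1 ++ l2) = p ++ tgt e :: l2.map tgt := by
      rw [walkWord_append, hp]; simp
    have hfin : (walkWord tgt x (l1 ++ e :: l2)).toFinset =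
        (walkWord tgt x (l1 ++ l2)).toFinset := by
      rw [hw, hw']; ext; simp
    have h1 := ih _ (by rw [hfin]; simp) src tgt (l1 ++ l2)
      (isWalk_append.2 ⟨_, hl1, hl2⟩) (by rw [hw'] ; rw [hw] at hc; exact hc.dedup) rfl
    have h2 := tendsto_graphSum_loop hS hst h1
    rw [mul_zero] at h2
    rw [hfin]
    exact h2.congr fun N => graphSum_perm List.perm_middle.symm
  by_cases hsing : ∃ v, v ≠ x ∧ v ∈ E.map tgt ∧ (E.map tgt).count v ≤ 1
  · obtain ⟨v, hvx, hvE, hcount⟩ := hsing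
    obtain ⟨e, he, htv⟩ := List.mem_map.1 hvE
    obtain ⟨l1, l2, rfl⟩ := List.append_of_mem he
    obtain ⟨u, hl1, hu, hl2⟩ := isWalk_append.1 hE
    have hl2' := hl2
    rcases l2 with _ | ⟨e', l2⟩
    · exact absurd (htv.symm.trans hl2) hvx
    obtain ⟨hse', hl2⟩ := hl2
    rw [htv] at hse'
    have hcount' : (l1.map tgt).count v = 0 ∧ (walkWord tgt (tgt e') l2).count v = 0 := by
      have h1 : (l1 ++ e :: e' :: l2).map tgt = l1.map tgt ++ v :: walkWord tgt (tgt e') l2 := by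
        simp [htv, walkWord]
      rw [h1, List.count_append, List.count_cons_self] at hcount
      omega
    have hv1 : v ∉ l1.map tgt := List.count_eq_zero.1 hcount'.1
    have hv2 : v ∉ walkWord tgt (tgt e') l2 := List.count_eq_zero.1 hcount'.2
    have hvw : v ∉ walkWord tgt x l1 := by
      simpa [walkWord, hvx] using hv1
    have htouch : ∀ f ∈ l1 ++ l2, src f ≠ v ∧ tgt f ≠ v := by
      intro f hf
      rcases List.mem_append.1 hf with hf | hf
      · exact ⟨ne_of_mem_of_not_mem (hl1.src_mem hf) hvw, ne_of_mem_of_not_mem (tgt_mem hf) hvw⟩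
      · exact ⟨ne_of_mem_of_not_mem (hl2.src_mem hf) hv2, ne_of_mem_of_not_mem (tgt_mem hf) hv2⟩
    have hperm : (l1 ++ e :: e' :: l2).Perm (e :: e' :: (l1 ++ l2)) :=
      List.perm_middle.trans (List.perm_middle.cons e)
    set σ := (walkWord tgt x l1 ++ walkWord tgt (tgt e') l2).toFinset with hσ
    have hvσ : v ∉ σ := by simp [hσ, hvw, hv2]
    have hfin : (walkWord tgt x (l1 ++ e :: e' :: l2)).toFinset = insert v σ := by
      rw [walkWord_append, hσ]; ext; simp [htv, walkWord]; grind
    have huσ : src e ∈ σ := by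
      rw [hu, hσ]; simp [hl1.end_mem]
    have hwσ : tgt e' ∈ σ := by
      rw [hσ]; simp [walkWord]
    rw [hfin]
    by_cases huw : tgt e' = src e
    · obtain ⟨p, hp⟩ := hl1.exists_walkWord_eq
      have hueq : tgt e' = u := huw.trans hu
      have hw : walkWord tgt x (l1 ++ e :: e' :: l2) = p ++ u :: v :: u :: l2.map tgt := by
        rw [walkWord_append, hp]; simp [htv, hueq]
      have hw' : walkWord tgt x (l1 ++ l2) = p ++ u :: l2.map tgt := by
        rw [walkWord_append, hp]; simp
      have hσ' : (walkWord tgt x (l1 ++ l2)).toFinset = σ := by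
        rw [hσ, hw', hp]; ext; simp [walkWord, hueq]
      have hcr : Crossing (walkWord tgt x (l1 ++ l2)) := by
        -- replacing `v` by its neighbour `u` turns the factor `u v u` of the word into `u u u`
        have hq : v ∉ l2.map tgt := fun h => hv2 (List.mem_cons_of_mem _ h)
        have hvp : v ∉ p ++ [u] := hp ▸ hvw
        have huv : u ≠ v := fun h => hvp (by simp [h])
        have hcount1 : (walkWord tgt x (l1 ++ e :: e' :: l2)).count v ≤ 1 := by
          simpa [walkWord, hvx.symm] using hcount
        have h1 := hc.map (z := u) hcount1
        rw [hw, List.map_append, List.map_cons, List.map_cons, List.map_cons, map_update_of_notMem hq,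
          map_update_of_notMem (fun h => hvp (by simp [h])), Function.update_self, Function.update_of_ne huv] at h1
        rw [hw']
        exact h1.dedup.dedup
      have h1 := ih _ (by rw [hfin, hσ', Finset.card_insert_of_notMem hvσ]; simp; omega) src tgt
        (l1 ++ l2) (isWalk_append.2 ⟨_, hl1, hueq ▸ hl2⟩) hcr rfl
      rw [hσ'] at h1
      exact (tendsto_graphSum_pendant hS hvσ htv hse' huσ huw htouch h1).congr
        fun N => graphSum_perm hperm.symm
    · have h0 := tendsto_graphSum_merge hS hvσ htv hse' huσ hwσ (Ne.symm huw) htouch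
        (M := fun _ => 0) (fun z hz => by
          have hx : Function.update id v z x = x := Function.update_of_ne hvx.symm _ _
          have hword := walkWord_map (tgt := tgt) (x := x) (E := l1 ++ e :: e' :: l2)
            (Function.update id v z)
          rw [hx] at hword
          have hfin' : ((walkWord tgt x (l1 ++ e :: e' :: l2)).map
              (Function.update id v z)).toFinset = σ :=
            toFinset_map_update hvσ hz hfin
          have h1 := ih _ (by rw [hword, hfin', hfin, Finset.card_insert_of_notMem hvσ]; omega)
            (Function.update id v z ∘ src) (Function.update id v z ∘ tgt) (l1 ++ e :: e' :: l2)
            (by simpa only [hx] using hE.map (Function.update id v z))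
            (by rw [hword]; exact hc.map (by simpa [walkWord, hvx.symm] using hcount)) rfl
          rw [hword, hfin'] at h1
          exact h1.congr fun N => graphSum_perm hperm)
      rw [Finset.sum_const_zero, neg_zero] at h0
      exact h0.congr fun N => graphSum_perm hperm.symm
  -- every vertex other than `x` is visited at least twice
  · push Not at hloop hsing
    have hE0 : E ≠ [] := by
      rintro rfl
      obtain ⟨a, b, hab, hs⟩ := hc
      simpa [walkWord] using hs.length_le
    have hxE : x ∈ E.map tgt := hE.end_mem_map hE0
    have hfin : (walkWord tgt x E).toFinset = (E.map tgt).toFinset := by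
      simp only [walkWord, List.toFinset_cons]
      exact Finset.insert_eq_self.2 (List.mem_toFinset.2 hxE)
    refine tendsto_graphSum_zero hS hloop (fun e he => List.mem_toFinset.2 (hE.src_mem he))
      (fun e he => List.mem_toFinset.2 (tgt_mem he)) ?_
    rw [hfin]
    have h1 : ∑ v ∈ (E.map tgt).toFinset, (E.map tgt).count v = E.length := by
      rw [List.sum_toFinset_count_eq_length, List.length_map]
    have hxf := List.mem_toFinset.2 hxE
    rw [← Finset.add_sum_erase _ _ hxf] at h1
    have h2 : (((E.map tgt).toFinset.erase x).card) * 2 ≤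
        ∑ v ∈ (E.map tgt).toFinset.erase x, (E.map tgt).count v := by
      rw [← smul_eq_mul]
      refine Finset.card_nsmul_le_sum _ _ _ fun v hv => ?_
      rw [Finset.mem_erase, List.mem_toFinset] at hv
      exact hsing v hv.1 hv.2
    have h3 := List.count_pos_iff.2 hxE
    rw [Finset.card_erase_of_mem hxf] at h2
    have h4 := Finset.card_pos.2 ⟨x, hxf⟩
    omega

end Crossing

/-! ### Inserting a cycle into a closed walk -/

section Leaf

variable {α β : Type*} [Fintype α] [DecidableEq α] {n : ℕ → ℕ}
  {S : ∀ N, Matrix (Fin (n N)) (Fin (n N)) ℂ} {s : ℝ}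

/-- Inserting into a closed walk, at a vertex `y`, a cycle of length `l` whose other vertices are
new multiplies the limit by `A_l`. For `l ≥ 3` the first new vertex of the cycle is identified with
every other vertex `z`: if `z` is the target of the `i`-th of the remaining edges of the cycle, the
cycle breaks into two, of lengths `i` and `l - i`, and otherwise the walk becomes crossing. This is
the recursion of the numbers `A_l`. -/
theorem tendsto_graphSum_insert_cycle (hS : IsScaledConferenceSeq S s) (x : α) (F : List β)
    (src tgt : β → α) (l1 l2 : List β) (y : α) (L : ℂ) (hF0 : F ≠ [])
    (h1 : IsWalk src tgt x l1 y) (hF : IsWalk src tgt y F y) (h2 : IsWalk src tgt y l2 x)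
    (hnd : (F.map tgt).Nodup)
    (hnew : ∀ v ∈ F.map tgt, v ≠ y → v ∉ walkWord tgt x l1 ∧ v ∉ walkWord tgt y l2)
    (hL : Tendsto (fun N => graphSum (S N) src tgt (walkWord tgt x (l1 ++ l2)).toFinset (l1 ++ l2))
      atTop (𝓝 L)) :
    Tendsto (fun N => graphSum (S N) src tgt (walkWord tgt x (l1 ++ F ++ l2)).toFinset
      (l1 ++ F ++ l2)) atTop (𝓝 (cycleWeight s F.length * L)) := by
  induction hm : F.length using Nat.strong_induction_on generalizing src tgt F l1 l2 y L with
  | _ m ih =>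
  subst hm
  obtain ⟨P, hP⟩ := h1.exists_walkWord_eq
  rcases F with _ | ⟨e0, G⟩
  · exact absurd rfl hF0
  obtain ⟨hse0, hG⟩ := hF
  rcases G with _ | ⟨e1, F'⟩
  · rw [isWalk_nil] at hG
    have hfin : (walkWord tgt x (l1 ++ [e0] ++ l2)).toFinset =
        (walkWord tgt x (l1 ++ l2)).toFinset := by
      rw [List.append_assoc, walkWord_append, walkWord_append, hP]
      ext; simp [hG]
    have hw : cycleWeight s [e0].length = s := by simp [cycleWeight]
    rw [hfin, hw]
    refine (tendsto_graphSum_loop hS (hse0.trans hG.symm) hL).congr fun N => graphSum_perm ?_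
    rw [List.append_assoc]
    exact List.perm_middle.symm
  set v := tgt e0 with hv
  obtain ⟨hse1, hF'⟩ := id hG
  have hGv : v ∉ (e1 :: F').map tgt := (List.nodup_cons.1 hnd).1
  have hGnd : ((e1 :: F').map tgt).Nodup := (List.nodup_cons.1 hnd).2
  have hyG : y ∈ (e1 :: F').map tgt := hG.end_mem_map (by simp)
  have hvy : v ≠ y := fun h => hGv (h ▸ hyG)
  have hvnew := hnew v (by simp [hv]) hvy
  have htouch : ∀ f ∈ l1 ++ l2, src f ≠ v ∧ tgt f ≠ v := by
    intro f hf
    rcases List.mem_append.1 hf with hf | hf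
    · exact ⟨ne_of_mem_of_not_mem (h1.src_mem hf) hvnew.1,
        ne_of_mem_of_not_mem (tgt_mem hf) hvnew.1⟩
    · exact ⟨ne_of_mem_of_not_mem (h2.src_mem hf) hvnew.2,
        ne_of_mem_of_not_mem (tgt_mem hf) hvnew.2⟩
  have hv2 : v ∉ l2.map tgt := fun h => hvnew.2 (List.mem_cons_of_mem _ h)
  rcases F' with _ | ⟨e2, F''⟩
  · rw [isWalk_nil] at hF'
    have hvσ : v ∉ (walkWord tgt x (l1 ++ l2)).toFinset := by
      rw [walkWord_append]
      simpa using ⟨hvnew.1, by simpa using hv2⟩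
    have hfin : (walkWord tgt x (l1 ++ [e0, e1] ++ l2)).toFinset =
        insert v (walkWord tgt x (l1 ++ l2)).toFinset := by
      rw [List.append_assoc, walkWord_append, walkWord_append, hP]
      ext; simp [hF', ← hv]
    have hy : y ∈ (walkWord tgt x (l1 ++ l2)).toFinset := by
      rw [walkWord_append, hP]; simp
    rw [hfin]
    have hw : cycleWeight s [e0, e1].length = 1 := by simp [cycleWeight]
    rw [hw, Complex.ofReal_one, one_mul]
    refine (tendsto_graphSum_pendant hS hvσ rfl hse1 (hse0.symm ▸ hy) (hF'.trans hse0.symm) htouch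
      hL).congr fun N => graphSum_perm ?_
    rw [List.append_assoc]
    exact ((List.perm_middle).trans ((List.perm_middle).cons e0)).symm
  set G := e1 :: e2 :: F'' with hGdef
  have hGlen : G.length = F''.length + 2 := rfl
  set σ := (walkWord tgt x l1 ++ G.map tgt ++ l2.map tgt).toFinset with hσ
  have hvσ : v ∉ σ := by
    simp only [hσ, List.mem_toFinset, List.mem_append, not_or]
    exact ⟨⟨hvnew.1, hGv⟩, hv2⟩
  have hword : walkWord tgt x (l1 ++ (e0 :: G) ++ l2) =
      walkWord tgt x l1 ++ v :: (G.map tgt ++ l2.map tgt) := by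
    rw [List.append_assoc, walkWord_append]; simp [hv]
  have hfin : (walkWord tgt x (l1 ++ (e0 :: G) ++ l2)).toFinset = insert v σ := by
    rw [hword, hσ]; ext; simp only [List.mem_toFinset, List.mem_append, List.mem_cons,
      Finset.mem_insert]; tauto
  have huσ : src e0 ∈ σ := by
    rw [hse0, hσ, List.mem_toFinset, hP]; simp
  have hwσ : tgt e1 ∈ σ := by
    rw [hσ, hGdef]; simp
  have huw : src e0 ≠ tgt e1 := by
    rw [hse0]
    intro h
    have h3 : y ∈ (e2 :: F'').map tgt := hF'.end_mem_map (by simp)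
    exact (List.nodup_cons.1 hGnd).1 (h ▸ h3)
  have hwalk : IsWalk src tgt x (l1 ++ (e0 :: G) ++ l2) x := by
    rw [List.append_assoc]
    exact isWalk_append.2 ⟨y, h1, isWalk_append.2 ⟨y, ⟨hse0, hG⟩, h2⟩⟩
  have hvx : x ≠ v := fun h => hvnew.1 (h ▸ start_mem)
  have hperm : (l1 ++ (e0 :: G) ++ l2).Perm (e0 :: e1 :: (l1 ++ (e2 :: F'') ++ l2)) := by
    rw [List.append_assoc, List.append_assoc]
    exact List.perm_middle.trans (List.perm_middle.cons e0)
  have htouch' : ∀ f ∈ l1 ++ (e2 :: F'') ++ l2, src f ≠ v ∧ tgt f ≠ v := by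
    intro f hf
    rcases List.mem_append.1 hf with hf | hf
    · rcases List.mem_append.1 hf with hf | hf
      · exact htouch f (List.mem_append_left _ hf)
      · exact ⟨ne_of_mem_of_not_mem (hF'.src_mem hf) hGv, ne_of_mem_of_not_mem
          (tgt_mem (x := tgt e1) hf) hGv⟩
    · exact htouch f (List.mem_append_right _ hf)
  set M : α → ℂ := fun z => if z ∈ G.map tgt then
    cycleWeight s ((G.map tgt).idxOf z + 1) *
      (cycleWeight s (G.length - (G.map tgt).idxOf z) * L) else 0 with hM
  have hmerge : ∀ z ∈ σ, Tendsto (fun N => graphSum (S N) (Function.update id v z ∘ src)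
      (Function.update id v z ∘ tgt) σ (l1 ++ (e0 :: G) ++ l2)) atTop (𝓝 (M z)) := by
    intro z hz
    set h := Function.update id v z with hh
    have hx : h x = x := Function.update_of_ne hvx _ _
    have hy : h y = y := Function.update_of_ne hvy.symm _ _
    have hhv : h v = z := Function.update_self ..
    have hzv : z ≠ v := ne_of_mem_of_not_mem hz hvσ
    have hhz : h z = z := Function.update_of_ne hzv _ _
    have hw : walkWord (h ∘ tgt) x (l1 ++ (e0 :: G) ++ l2) =
        (walkWord tgt x (l1 ++ (e0 :: G) ++ l2)).map h := by
      rw [← walkWord_map, hx]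
    have hwfin : (walkWord (h ∘ tgt) x (l1 ++ (e0 :: G) ++ l2)).toFinset = σ := by
      rw [hw]; exact toFinset_map_update hvσ hz hfin
    by_cases hzG : z ∈ G.map tgt
    · have hMz : M z = cycleWeight s ((G.map tgt).idxOf z + 1) *
          (cycleWeight s (G.length - (G.map tgt).idxOf z) * L) := if_pos hzG
      set i := (G.map tgt).idxOf z with hi
      have hi' : i < G.length := by
        have := List.idxOf_lt_length_of_mem hzG
        simpa using this
      have hzi : tgt G[i] = z := by
        have := List.getElem_idxOf (List.idxOf_lt_length_of_mem hzG)
        rwa [List.getElem_map] at this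
      have hsplit : G = G.take (i + 1) ++ G.drop (i + 1) := (List.take_append_drop ..).symm
      obtain ⟨A, hA⟩ : ∃ A, A = G.take (i + 1) := ⟨_, rfl⟩
      obtain ⟨B, hB⟩ : ∃ B, B = G.drop (i + 1) := ⟨_, rfl⟩
      rw [← hA, ← hB] at hsplit
      have hAz : A = G.take i ++ [G[i]] := by rw [hA, List.take_succ_eq_append_getElem hi']
      have hAB : IsWalk src tgt v A z ∧ IsWalk src tgt z B y := by
        rw [hsplit] at hG
        obtain ⟨z', hz1, hz2⟩ := isWalk_append.1 hG
        have : z' = z := by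
          rw [hAz] at hz1
          obtain ⟨z'', -, -, hz3⟩ := isWalk_append.1 hz1
          rw [isWalk_nil] at hz3
          rw [← hz3, hzi]
        rw [this] at hz1 hz2
        exact ⟨hz1, hz2⟩
      have hGmap : G.map tgt = (G.take i).map tgt ++ walkWord tgt z B := by
        conv_lhs => rw [hsplit, hAz]
        simp only [List.map_append, List.map_cons, hzi, walkWord, List.append_assoc,
          List.cons_append, List.nil_append]
      have hGnd' := hGnd
      rw [hGmap] at hGnd'
      have hnd1 := (List.nodup_append.1 hGnd')
      have hyB : y ∈ walkWord tgt z B := hAB.2.end_mem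
      have hBG : ∀ u ∈ walkWord tgt z B, u ∈ G.map tgt := fun u hu => by
        rw [hGmap]; exact List.mem_append_right _ hu
      have hmapB : B.map (h ∘ tgt) = B.map tgt := by
        rw [← List.map_map]
        exact map_update_of_notMem fun hc => hGv (hBG _ (List.mem_cons_of_mem _ hc))
      have hmapA : A.map (h ∘ tgt) = A.map tgt := by
        rw [← List.map_map]
        refine map_update_of_notMem fun hc => hGv ?_
        rw [hsplit, List.map_append]
        exact List.mem_append_left _ hc
      have hw1 : walkWord (h ∘ tgt) x l1 = walkWord tgt x l1 := by
        rw [← hx, walkWord_map, hx]; exact map_update_of_notMem hvnew.1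
      have hw2 : l2.map (h ∘ tgt) = l2.map tgt := by
        rw [← List.map_map]; exact map_update_of_notMem hv2
      have hid : ∀ a, a ≠ v → a = h a := fun a ha => by simp [hh, ha]
      have hcongr : ∀ f ∈ l1 ++ l2, src f = (h ∘ src) f ∧ tgt f = (h ∘ tgt) f := fun f hf =>
        ⟨hid _ (htouch f hf).1, hid _ (htouch f hf).2⟩
      have hl1 : IsWalk (h ∘ src) (h ∘ tgt) x l1 y :=
        h1.congr fun f hf => hcongr f (List.mem_append_left _ hf)
      have hl2 : IsWalk (h ∘ src) (h ∘ tgt) y l2 x :=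
        h2.congr fun f hf => hcongr f (List.mem_append_right _ hf)
      have hBwalk : IsWalk (h ∘ src) (h ∘ tgt) z B y := by
        have := hAB.2.map h; rwa [hhz, hy] at this
      have hAwalk : IsWalk (h ∘ src) (h ∘ tgt) z A z := by
        have := hAB.1.map h; rwa [hhz, hhv] at this
      have he0 : IsWalk (h ∘ src) (h ∘ tgt) y (e0 :: B) y := by
        refine ⟨by simp [hse0, hy], ?_⟩
        have : (h ∘ tgt) e0 = z := by simp [← hv, hhv]
        rwa [this]
      have he0map : (e0 :: B).map (h ∘ tgt) = walkWord tgt z B := by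
        rw [List.map_cons, hmapB]; simp [← hv, hhv, walkWord]
      have hlenA : A.length = i + 1 := by rw [hA, List.length_take]; omega
      have hlenB : (e0 :: B).length = G.length - i := by
        rw [List.length_cons, hB, List.length_drop]; omega
      -- the cycle of the edges `e0` and `B`
      have hfirst := ih (e0 :: B).length (by simp only [List.length_cons] at hlenB ⊢; omega)
        (e0 :: B) (h ∘ src) (h ∘ tgt) l1 l2 y L (by simp) hl1 he0 hl2
        (by rw [he0map]; exact hnd1.2.1)
        (by
          intro u hu huy
          rw [he0map] at hu
          have := hnew u (List.mem_cons_of_mem _ (hBG u hu)) huy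
          rw [hw1]
          refine ⟨this.1, ?_⟩
          rw [walkWord, hw2]
          exact this.2)
        (by
          have e1 : walkWord (h ∘ tgt) x (l1 ++ l2) = walkWord tgt x (l1 ++ l2) := by
            rw [walkWord_append, walkWord_append, hw1, hw2]
          rw [e1]
          exact hL.congr fun N => graphSum_congr hcongr)
        rfl
      -- the cycle `A`, inserted at `z`
      have hsecond := ih A.length (by simp only [List.length_cons]; omega)
        A (h ∘ src) (h ∘ tgt) (l1 ++ [e0]) (B ++ l2) z _
        (by intro hc; rw [hc] at hlenA; simp at hlenA)
        (isWalk_append.2 ⟨y, hl1, by simp [hse0, hy], by simp [← hv, hhv]⟩) hAwalk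
        (isWalk_append.2 ⟨y, hBwalk, hl2⟩)
        (by
          rw [hmapA]
          refine hGnd.sublist ?_
          rw [hA]
          exact (List.take_sublist _ _).map _)
        (by
          intro u hu huz
          rw [hmapA, hAz] at hu
          have hu' : u ∈ (G.take i).map tgt := by
            rw [List.map_append, List.mem_append] at hu
            rcases hu with hu | hu
            · exact hu
            · exact absurd (by simpa [hzi] using hu) huz
          have huB : u ∉ walkWord tgt z B := fun hc => hnd1.2.2 _ hu' _ hc rfl
          have huy : u ≠ y := fun hc => huB (hc ▸ hyB)
          have := hnew u (List.mem_cons_of_mem _ (by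
            rw [hGmap]; exact List.mem_append_left _ hu')) huy
          constructor
          · rw [walkWord_append, hw1, List.mem_append, not_or]
            exact ⟨this.1, by simpa [← hv, hhv] using huz⟩
          · rw [walkWord, List.map_append, hmapB, hw2, ← List.cons_append, List.mem_append, not_or]
            exact ⟨huB, fun hc => this.2 (List.mem_cons_of_mem _ hc)⟩)
        (by
          have e1 : l1 ++ [e0] ++ (B ++ l2) = l1 ++ (e0 :: B) ++ l2 := by simp
          rw [e1]
          exact hfirst)
        rfl
      have e2 : l1 ++ [e0] ++ A ++ (B ++ l2) = l1 ++ (e0 :: G) ++ l2 := by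
        rw [hsplit]; simp
      rw [e2, hwfin, hlenA, hlenB] at hsecond
      rw [hMz]
      exact hsecond
    · have hMz : M z = 0 := if_neg hzG
      rw [hMz, ← hwfin]
      refine tendsto_graphSum_of_crossing hS _ _ _ _
        (by simpa only [hx] using hwalk.map h) ?_
      have hzy : z ≠ y := fun hc => hzG (hc ▸ hyG)
      have hvP : v ∉ P := fun hc => hvnew.1 (by rw [hP]; simp [hc])
      have hword' : walkWord (h ∘ tgt) x (l1 ++ (e0 :: G) ++ l2) =
          P ++ (y :: z :: (G.map tgt ++ l2.map tgt)) := by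
        rw [hw, hword, hP]
        simp only [List.map_append, List.map_cons, List.map_nil]
        rw [map_update_of_notMem hvP, hhv, hy, map_update_of_notMem hGv, map_update_of_notMem hv2]
        simp
      rw [hword']
      have hz' : z ∈ P ∨ z ∈ l2.map tgt := by
        simp only [hσ, List.mem_toFinset, List.mem_append, hP, List.mem_singleton] at hz
        tauto
      have hyG' : [y].Sublist (G.map tgt) := List.singleton_sublist.2 hyG
      rcases hz' with hz' | hz'
      · exact ⟨z, y, hzy, (List.singleton_sublist.2 hz').append
          (((hyG'.trans (List.sublist_append_left _ _)).cons_cons z).cons_cons y)⟩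
      · exact ⟨y, z, hzy.symm, List.Sublist.trans
          (((hyG'.append (List.singleton_sublist.2 hz')).cons_cons z).cons_cons y)
          (List.sublist_append_right _ _)⟩
  have hsum : -∑ z ∈ σ, M z = cycleWeight s (e0 :: G).length * L := by
    have hsub : (G.map tgt).toFinset ⊆ σ := by
      intro z hz
      simp only [hσ, List.mem_toFinset, List.mem_append] at hz ⊢
      tauto
    rw [← Finset.sum_subset hsub (fun z _ hz => by
      simp only [hM]; rw [if_neg (fun hc => hz (List.mem_toFinset.2 hc))])]
    rw [List.sum_toFinset _ hGnd, List.length_cons, hGlen, cycleWeight]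
    have e3 : ((G.map tgt).map M) = List.ofFn fun i : Fin (F''.length + 2) =>
        ((cycleWeight s (i + 1) * cycleWeight s (F''.length + 2 - i) : ℝ) : ℂ) * L := by
      apply List.ext_getElem
      · simp [hGlen]
      · intro i hi1 hi2
        rw [List.getElem_map, List.getElem_ofFn]
        have hi : i < (G.map tgt).length := by simpa using hi1
        simp only [hM]
        rw [if_pos (List.getElem_mem hi), hGnd.idxOf_getElem, hGlen]
        push_cast
        ring
    rw [e3, List.sum_ofFn, ← Finset.sum_mul]
    push_cast
    ring
  rw [hfin, ← hsum]
  exact (tendsto_graphSum_merge hS hvσ rfl hse1 huσ hwσ huw htouch' fun z hz =>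
    (hmerge z hz).congr fun N => graphSum_perm hperm).congr fun N => graphSum_perm hperm.symm

end Leaf

/-! ### Simple cycles of a closed walk -/

section Cycles

variable {α β : Type*} {G : Graph α β} {src tgt : β → α}

/-- `G` is the undirected multigraph underlying the digraph with edges `src e → tgt e`. -/
def IsUnderlying (G : Graph α β) (src tgt : β → α) : Prop :=
  ∀ e u w, G.IsLink e u w ↔ s(u, w) = s(src e, tgt e)

theorem IsWalk.src_getElem_zero {x y : α} {E : List β} (hE : IsWalk src tgt x E y)
    (h : 0 < E.length) : src E[0] = x := by
  cases E with
  | nil => simp at h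
  | cons e E => exact hE.1

theorem IsWalk.src_getElem_succ {x y : α} {E : List β} (hE : IsWalk src tgt x E y) {i : ℕ}
    (h : i + 1 < E.length) : src E[i + 1] = tgt E[i] := by
  induction E generalizing x i with
  | nil => simp at h
  | cons e E ih =>
    cases i with
    | zero => simpa using hE.2.src_getElem_zero (by simpa using h)
    | succ i => simpa using ih hE.2 (i := i) (by simpa using h)

theorem IsWalk.tgt_getElem_last {x y : α} {E : List β} (hE : IsWalk src tgt x E y) {i : ℕ}
    (h : i + 1 = E.length) : tgt E[i] = y := by
  induction E generalizing x i with
  | nil => simp at h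
  | cons e E ih =>
    cases i with
    | zero =>
      obtain rfl : E = [] := List.length_eq_zero_iff.1 (by simpa using h.symm)
      exact hE.2
    | succ i => simpa using ih hE.2 (i := i) (by simpa using h)

theorem finRotate_ne_self {l : ℕ} (hl : 2 ≤ l) (r : Fin l) : finRotate l r ≠ r := by
  obtain ⟨m, rfl⟩ := Nat.exists_eq_add_of_le' hl
  rw [finRotate_apply]
  simp

theorem forall_of_finRotate {l : ℕ} {P : Fin l → Prop} (h : ∀ r, P r → P (finRotate l r))
    {r : Fin l} (hr : P r) (q : Fin l) : P q := by
  rcases l with _ | m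
  · exact q.elim0
  have key : ∀ k : ℕ, P (r + (Fin.ofNat (m + 1) k)) := by
    intro k
    induction k with
    | zero => simpa using hr
    | succ k ih =>
      have := h _ ih
      rw [finRotate_apply] at this
      convert this using 1
      rw [add_assoc]
      congr 1
      ext
      simp [Fin.val_add]
  have := key (q - r).val
  simpa using this

theorem val_finRotate {l : ℕ} (r : Fin l) :
    ((finRotate l r : Fin l) : ℕ) = if r.val + 1 = l then 0 else r.val + 1 := by
  rcases l with _ | m
  · exact r.elim0
  rw [coe_finRotate]
  simp [Fin.ext_iff]

/-- A closed walk without repeated vertices is a simple cycle. -/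
theorem IsWalk.isSimpleCycle [DecidableEq β] (hG : IsUnderlying G src tgt) {y : α} {F : List β}
    (hF : IsWalk src tgt y F y) (h0 : F ≠ []) (hnd : (F.map tgt).Nodup) :
    IsSimpleCycle G F.toFinset := by
  have hrot : ∀ r : Fin F.length, src F[(finRotate F.length r)] = tgt F[r] := by
    intro r
    have hr := val_finRotate r
    split_ifs at hr with h
    · have h1 : src F[(finRotate F.length r)] = src F[0] := by simp only [Fin.getElem_fin, hr]
      rw [h1, hF.src_getElem_zero, Fin.getElem_fin, hF.tgt_getElem_last h]
    · have h1 : r.val + 1 < F.length := by omega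
      have h2 : src F[(finRotate F.length r)] = src F[r.val + 1] := by simp only [Fin.getElem_fin, hr]
      rw [h2, hF.src_getElem_succ h1, Fin.getElem_fin]
  have hinj : Function.Injective fun r : Fin F.length => tgt F[r] := by
    intro r r' h
    have h1 : (F.map tgt)[r.val]'(by simp) = (F.map tgt)[r'.val]'(by simp) := by simpa using h
    exact Fin.ext (hnd.getElem_inj_iff.1 h1)
  refine ⟨F.length, fun r => src F[r], fun r => F[r], List.length_pos_of_ne_nil h0, ?_, ?_, ?_, ?_⟩
  · intro r r' h
    obtain ⟨q, rfl⟩ := (finRotate _).surjective r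
    obtain ⟨q', rfl⟩ := (finRotate _).surjective r'
    exact congrArg _ (hinj ((hrot q).symm.trans (h.trans (hrot q'))))
  · intro r r' h
    exact hinj (congrArg tgt h)
  · intro r
    rw [hG]
    simp only [hrot]
  · ext e
    simp only [List.coe_toFinset, Set.mem_ofPred_eq, Set.mem_range, List.mem_iff_get]
    rfl

theorem IsSimpleCycle.eq_singleton_of_loop (hG : IsUnderlying G src tgt) {C : Finset β}
    (hC : IsSimpleCycle G C) {e : β} (he : e ∈ C) (hloop : src e = tgt e) : ∀ f ∈ C, f = e := by
  obtain ⟨l, v, g, hl, hv, hg, hlink, hCg⟩ := hC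
  obtain ⟨r, rfl⟩ : e ∈ Set.range g := hCg ▸ he
  have h1 := (hG _ _ _).1 (hlink r)
  rw [hloop] at h1
  have h2 : v r = v (finRotate l r) := by
    rw [Sym2.eq_iff] at h1
    rcases h1 with ⟨h, h'⟩ | ⟨h, h'⟩ <;> rw [h, h']
  have hl1 : l = 1 := by
    by_contra hne
    exact finRotate_ne_self (by omega) r (hv h2).symm
  subst hl1
  intro f hf
  obtain ⟨r', rfl⟩ : f ∈ Set.range g := hCg ▸ hf
  rw [Subsingleton.elim r r']

/-- Besides an edge of a simple cycle which is not a loop, the cycle contains a second edge at each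
of its ends. -/
theorem IsSimpleCycle.exists_ne_incident (hG : IsUnderlying G src tgt) {C : Finset β}
    (hC : IsSimpleCycle G C) {e : β} (he : e ∈ C) (hloop : src e ≠ tgt e) {u : α}
    (hu : src e = u ∨ tgt e = u) : ∃ f ∈ C, f ≠ e ∧ (src f = u ∨ tgt f = u) := by
  obtain ⟨l, v, g, hl, hv, hg, hlink, hCg⟩ := hC
  obtain ⟨r, rfl⟩ : e ∈ Set.range g := hCg ▸ he
  have hinc : ∀ q w, (v q = w ∨ v (finRotate l q) = w) ↔ (src (g q) = w ∨ tgt (g q) = w) := by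
    intro q w
    have h1 := (hG _ _ _).1 (hlink q)
    have h2 : w ∈ s(v q, v (finRotate l q)) ↔ w ∈ s(src (g q), tgt (g q)) := by rw [h1]
    simpa [eq_comm] using h2
  have hl2 : 2 ≤ l := by
    by_contra hne
    obtain rfl : l = 1 := by omega
    have h1 := (hG _ _ _).1 (hlink r)
    rw [Subsingleton.elim (finRotate 1 r) r, Sym2.eq_iff] at h1
    rcases h1 with ⟨h, h'⟩ | ⟨h, h'⟩
    · exact hloop (h.symm.trans h')
    · exact hloop (h'.symm.trans h)
  have hmem : ∀ q, g q ∈ C := fun q => by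
    have : g q ∈ (C : Set β) := hCg ▸ Set.mem_range_self q
    exact this
  rcases (hinc r u).2 hu with h | h
  · refine ⟨g ((finRotate l).symm r), hmem _, fun hc => ?_, (hinc _ _).1 (Or.inr ?_)⟩
    · have := hg hc
      exact finRotate_ne_self hl2 r (by conv_lhs => rw [← this, Equiv.apply_symm_apply])
    · rw [Equiv.apply_symm_apply, h]
  · exact ⟨g (finRotate l r), hmem _, fun hc => finRotate_ne_self hl2 r (hg hc),
      (hinc _ _).1 (Or.inl h)⟩

/-- A simple cycle does not properly contain another one: following the larger cycle, an edge of the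
smaller one is succeeded by an edge of the smaller one. -/
theorem IsSimpleCycle.eq_of_subset (hG : IsUnderlying G src tgt) {F C : Finset β}
    (hF : IsSimpleCycle G F) (hC : IsSimpleCycle G C) (hFC : F ⊆ C) : F = C := by
  have hne : ∃ e, e ∈ F := by
    obtain ⟨l, v, g, hl, -, -, -, hCg⟩ := hF
    exact ⟨g ⟨0, hl⟩, by
      have : g ⟨0, hl⟩ ∈ (F : Set β) := hCg ▸ Set.mem_range_self _
      exact this⟩
  obtain ⟨e, he⟩ := hne
  by_cases hloop : ∃ e ∈ F, src e = tgt e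
  · obtain ⟨e, he, hl⟩ := hloop
    refine hFC.antisymm fun f hf => ?_
    rw [hC.eq_singleton_of_loop hG (hFC he) hl f hf]
    exact he
  push Not at hloop
  obtain ⟨l, v, g, hl, hv, hg, hlink, hCg⟩ := hC
  obtain ⟨r, rfl⟩ : e ∈ Set.range g := hCg ▸ hFC he
  have hinc : ∀ q w, (src (g q) = w ∨ tgt (g q) = w) → (v q = w ∨ v (finRotate l q) = w) := by
    intro q w
    have h1 := (hG _ _ _).1 (hlink q)
    have h2 : w ∈ s(v q, v (finRotate l q)) ↔ w ∈ s(src (g q), tgt (g q)) := by rw [h1]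
    intro h
    simpa [eq_comm] using h2.2 (by simpa [eq_comm] using h)
  have hend : ∀ q, src (g q) = v (finRotate l q) ∨ tgt (g q) = v (finRotate l q) := by
    intro q
    have h1 := (hG _ _ _).1 (hlink q)
    have h2 : v (finRotate l q) ∈ s(src (g q), tgt (g q)) := by rw [← h1]; simp
    simpa [eq_comm] using h2
  have hall : ∀ q, g q ∈ F := forall_of_finRotate (P := fun q => g q ∈ F) (fun q hq => by
    obtain ⟨f, hf, hfne, hfinc⟩ := hF.exists_ne_incident hG hq (hloop _ hq) (hend q)
    obtain ⟨q', rfl⟩ : f ∈ Set.range g := hCg ▸ hFC hf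
    rcases hinc _ _ hfinc with h | h
    · rwa [hv h] at hf
    · exact absurd (congrArg g ((finRotate l).injective (hv h))) hfne) he
  refine hFC.antisymm fun f hf => ?_
  obtain ⟨q, rfl⟩ : f ∈ Set.range g := hCg ▸ hf
  exact hall q

/-- If a closed walk `E` contains a cycle `F` whose vertices other than `y` do not occur elsewhere,
then the only simple cycle in `E` which meets `F` is `F`: it passes through the vertices of degree
two of `F`. -/
theorem IsSimpleCycle.eq_of_not_disjoint [DecidableEq β] (hG : IsUnderlying G src tgt) {y : α}
    {F : List β} {R : List β} (hF : IsWalk src tgt y F y) (hnd : (F.map tgt).Nodup)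
    (hnew : ∀ v ∈ F.map tgt, v ≠ y → ∀ f ∈ R, src f ≠ v ∧ tgt f ≠ v) {C : Finset β}
    (hC : IsSimpleCycle G C) (hCE : ∀ f ∈ C, f ∈ F ∨ f ∈ R) {e : β} (heF : e ∈ F) (heC : e ∈ C) :
    C = F.toFinset := by
  have h0 : F ≠ [] := List.ne_nil_of_mem heF
  have hcyc := hF.isSimpleCycle hG h0 hnd
  refine (hcyc.eq_of_subset hG hC ?_).symm
  by_cases hloop : ∃ e ∈ F, src e = tgt e
  · obtain ⟨f, hf, hl⟩ := hloop
    have := hcyc.eq_singleton_of_loop hG (List.mem_toFinset.2 hf) hl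
    intro f' hf'
    rw [this f' hf', ← this e (List.mem_toFinset.2 heF)]
    exact heC
  push Not at hloop
  have htgt : ∀ {i j : ℕ} (hi : i < F.length) (hj : j < F.length), tgt F[i] = tgt F[j] → i = j := by
    intro i j hi hj h
    have hi' : i < (F.map tgt).length := by simpa using hi
    have hj' : j < (F.map tgt).length := by simpa using hj
    exact (hnd.getElem_inj_iff (hi := hi') (hj := hj')).1 (by simpa using h)
  -- consecutive edges of `F` meet in a vertex of degree two
  have hinc : ∀ (i : ℕ) (hi : i + 1 < F.length) (f : β), f ∈ C →
      (src f = tgt F[i] ∨ tgt f = tgt F[i]) → f = F[i] ∨ f = F[i + 1] := by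
    intro i hi f hf hfi
    have hiy : tgt F[i] ≠ y := by
      obtain ⟨m, hm⟩ : ∃ m, m + 1 = F.length := ⟨F.length - 1, by omega⟩
      rw [← hF.tgt_getElem_last hm]
      intro h
      have := htgt _ _ h
      omega
    rcases hCE f hf with hfF | hfR
    · obtain ⟨j, hj, rfl⟩ := List.getElem_of_mem hfF
      rcases hfi with h | h
      · right
        rcases j with _ | j
        · exact absurd (h.symm.trans (hF.src_getElem_zero hj)) hiy
        · rw [hF.src_getElem_succ hj] at h
          obtain rfl := htgt _ _ h
          rfl
      · left
        obtain rfl := htgt _ _ h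
        rfl
    · exfalso
      have := hnew _ (List.mem_map_of_mem (List.getElem_mem _)) hiy f hfR
      exact hfi.elim this.1 this.2
  have hstep : ∀ (i : ℕ) (hi : i + 1 < F.length), F[i] ∈ C ↔ F[i + 1] ∈ C := by
    intro i hi
    constructor
    · intro h
      obtain ⟨f, hf, hne, hfi⟩ := hC.exists_ne_incident hG h
        (hloop _ (List.getElem_mem _)) (Or.inr rfl)
      rcases hinc i hi f hf hfi with rfl | rfl
      · exact absurd rfl hne
      · exact hf
    · intro h
      obtain ⟨f, hf, hne, hfi⟩ := hC.exists_ne_incident hG h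
        (hloop _ (List.getElem_mem _)) (Or.inl (hF.src_getElem_succ hi))
      rcases hinc i hi f hf hfi with rfl | rfl
      · exact hf
      · exact absurd rfl hne
  have hall : ∀ (i : ℕ) (hi : i < F.length), F[i] ∈ C ↔ F[0] ∈ C := by
    intro i
    induction i with
    | zero => intro _; rfl
    | succ i ih => intro hi; rw [← hstep i hi, ih]
  obtain ⟨j, hj, rfl⟩ := List.getElem_of_mem heF
  intro f hf
  obtain ⟨i, hi, rfl⟩ := List.getElem_of_mem (List.mem_toFinset.1 hf)
  exact (hall i hi).2 ((hall j hj).1 heC)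

end Cycles

section Leaves

variable {α β : Type*} {src tgt : β → α}

/-- A shortest closed piece of a closed walk repeats no vertex. -/
theorem IsWalk.exists_cycle {x : α} {E : List β} (hE : IsWalk src tgt x E x) (h0 : E ≠ []) :
    ∃ y l1 F l2, E = l1 ++ F ++ l2 ∧ F ≠ [] ∧ IsWalk src tgt x l1 y ∧ IsWalk src tgt y F y ∧
      IsWalk src tgt y l2 x ∧ (F.map tgt).Nodup := by
  induction hm : E.length using Nat.strong_induction_on generalizing x E with
  | _ m ih =>
  subst hm
  by_cases hnd : (E.map tgt).Nodup
  · exact ⟨x, [], E, [], by simp, h0, rfl, hE, rfl, hnd⟩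
  obtain ⟨a, e, b, e', c, rfl, hee⟩ : ∃ a e b e' c, E = a ++ e :: (b ++ e' :: c) ∧
      tgt e = tgt e' := by
    clear ih h0 hE
    induction E with
    | nil => simp at hnd
    | cons e E ihE =>
      rw [List.map_cons, List.nodup_cons] at hnd
      by_cases he : tgt e ∈ E.map tgt
      · obtain ⟨e', he', h⟩ := List.mem_map.1 he
        obtain ⟨b, c, rfl⟩ := List.append_of_mem he'
        exact ⟨[], e, b, e', c, rfl, h.symm⟩
      · obtain ⟨a, f, b, f', c, rfl, h⟩ := ihE fun h => hnd ⟨he, h⟩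
        exact ⟨e :: a, f, b, f', c, rfl, h⟩
  obtain ⟨u, ha, hu, hb⟩ := isWalk_append.1 hE
  obtain ⟨w, hb, hw, hc⟩ := isWalk_append.1 hb
  have hcl : IsWalk src tgt (tgt e) (b ++ [e']) (tgt e) :=
    isWalk_append.2 ⟨w, hb, hw, hee.symm⟩
  obtain ⟨y, l1, F, l2, hF1, hF0, h1, h2, h3, h4⟩ := ih (b ++ [e']).length
    (by simp; omega) hcl (by simp) rfl
  refine ⟨y, a ++ e :: l1, F, l2 ++ c, ?_, hF0, isWalk_append.2 ⟨u, ha, hu, h1⟩, h2,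
    isWalk_append.2 ⟨_, h3, hee ▸ hc⟩, h4⟩
  have : b ++ e' :: c = (b ++ [e']) ++ c := by simp
  rw [this, hF1]
  simp

/-- In a noncrossing closed walk, the vertices of a closed piece other than its base point do not
occur outside of the piece. -/
theorem not_mem_of_not_crossing {x y : α} {l1 F l2 : List β}
    (hc : ¬ Crossing (walkWord tgt x (l1 ++ F ++ l2))) (h1 : IsWalk src tgt x l1 y)
    (hF : IsWalk src tgt y F y) {v : α} (hv : v ∈ F.map tgt) (hvy : v ≠ y) :
    v ∉ walkWord tgt x l1 ∧ v ∉ walkWord tgt y l2 := by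
  obtain ⟨P, hP⟩ := h1.exists_walkWord_eq
  obtain ⟨Q, hQ⟩ := hF.exists_walkWord_eq
  rcases F with _ | ⟨e, F⟩
  · simp at hv
  obtain ⟨Q', hQ'⟩ : ∃ Q', (e :: F).map tgt = Q' ++ [y] := by
    cases Q with
    | nil => simp [walkWord] at hQ
    | cons q Q => exact ⟨Q, by simpa [walkWord] using (List.cons.inj hQ).2⟩
  have hw : walkWord tgt x (l1 ++ (e :: F) ++ l2) = P ++ (y :: (Q' ++ (y :: l2.map tgt))) := by
    rw [List.append_assoc, walkWord_append, List.map_append, hQ', hP]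
    simp
  rw [hw] at hc
  have hvQ : [v].Sublist Q' := by
    rw [hQ', List.mem_append] at hv
    exact List.singleton_sublist.2 (hv.resolve_right (by simpa using hvy))
  constructor
  · intro h
    rw [hP, List.mem_append] at h
    have h' := List.singleton_sublist.2 (h.resolve_right (by simpa using hvy))
    exact hc ⟨v, y, hvy, h'.append ((hvQ.append
      ((List.nil_sublist (l2.map tgt)).cons_cons y)).cons_cons y)⟩
  · intro h
    have h' := List.singleton_sublist.2 ((List.mem_cons.1 h).resolve_left hvy)
    exact hc ⟨y, v, hvy.symm, ((hvQ.append (h'.cons_cons y)).cons_cons y).trans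
      (List.sublist_append_right _ _)⟩

end Leaves

/-! ### Noncrossing walks -/

section NonCrossing

variable {α β γ : Type*} [Fintype α] [DecidableEq α] [DecidableEq β] {n : ℕ → ℕ}
  {S : ∀ N, Matrix (Fin (n N)) (Fin (n N)) ℂ} {s : ℝ} {G : Graph γ β}

/-- The edges of a noncrossing closed walk fall into disjoint simple cycles, there are no other
simple cycles, and each of them contributes its weight to the limit: a shortest closed piece is a
cycle which meets the rest of the walk in one vertex only. -/
theorem exists_cycles_of_not_crossing (hS : IsScaledConferenceSeq S s) {ι : α → γ}
    (hι : Function.Injective ι) (src tgt : β → α) (hG : IsUnderlying G (ι ∘ src) (ι ∘ tgt))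
    (x : α) (E : List β) (hE : IsWalk src tgt x E x) (hnd : E.Nodup)
    (hc : ¬ Crossing (walkWord tgt x E)) :
    ∃ 𝒟 : Finset (Finset β), (∀ C, C ∈ 𝒟 ↔ IsSimpleCycle G C ∧ ∀ e ∈ C, e ∈ E) ∧
      (∀ C ∈ 𝒟, ∀ C' ∈ 𝒟, ∀ e ∈ C, e ∈ C' → C = C') ∧
      Tendsto (fun N => graphSum (S N) src tgt (walkWord tgt x E).toFinset E) atTop
        (𝓝 ((∏ C ∈ 𝒟, cycleWeight s C.card : ℝ) : ℂ)) := by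
  induction hm : E.length using Nat.strong_induction_on generalizing E with
  | _ m ih =>
  subst hm
  by_cases h0 : E = []
  · subst h0
    refine ⟨∅, fun C => ?_, by simp, by simpa [walkWord] using tendsto_graphSum_nil hS x⟩
    simp only [Finset.notMem_empty, false_iff, not_and]
    rintro ⟨l, v, g, hl, -, -, -, hCg⟩ h
    have : g ⟨0, hl⟩ ∈ (C : Set β) := hCg ▸ Set.mem_range_self _
    simpa using h _ this
  obtain ⟨y, l1, F, l2, rfl, hF0, h1, hF, h2, hFnd⟩ := hE.exists_cycle h0
  have hnew : ∀ v ∈ F.map tgt, v ≠ y → v ∉ walkWord tgt x l1 ∧ v ∉ walkWord tgt y l2 :=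
    fun v hv hvy => not_mem_of_not_crossing hc h1 hF hv hvy
  have hsub : (l1 ++ l2).Sublist (l1 ++ F ++ l2) :=
    (List.sublist_append_left _ _).append (List.Sublist.refl _)
  obtain ⟨𝒟, h𝒟, hdisj, hlim⟩ := ih (l1 ++ l2).length
    (by have := List.length_pos_of_ne_nil hF0; simp; omega)
    (l1 ++ l2) (isWalk_append.2 ⟨y, h1, h2⟩) (hnd.sublist hsub)
    (fun h => hc (h.of_sublist ((hsub.map tgt).cons_cons x))) rfl
  have hFι : IsWalk (ι ∘ src) (ι ∘ tgt) (ι y) F (ι y) := hF.map ι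
  have hFndι : (F.map (ι ∘ tgt)).Nodup := by
    rw [← List.map_map]; exact hFnd.map hι
  have hFcyc : IsSimpleCycle G F.toFinset := hFι.isSimpleCycle hG hF0 hFndι
  have hnd' : ∀ e ∈ F, e ∉ l1 ++ l2 := by
    intro e he he'
    rw [List.nodup_append, List.nodup_append] at hnd
    rcases List.mem_append.1 he' with h | h
    · exact hnd.1.2.2 _ h _ he rfl
    · exact hnd.2.2 _ (List.mem_append_right _ he) _ h rfl
  have huniq : ∀ C, IsSimpleCycle G C → (∀ e ∈ C, e ∈ l1 ++ F ++ l2) → ∀ e ∈ F, e ∈ C →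
      C = F.toFinset := by
    intro C hC hCE e heF heC
    refine IsSimpleCycle.eq_of_not_disjoint hG (R := l1 ++ l2) hFι hFndι ?_ hC ?_ heF heC
    · intro v hv hvy f hf
      rw [← List.map_map, List.mem_map] at hv
      obtain ⟨v, hv, rfl⟩ := hv
      have h3 := hnew v hv (fun h => hvy (congrArg ι h))
      rw [Function.comp_apply, Function.comp_apply, hι.ne_iff, hι.ne_iff]
      rcases List.mem_append.1 hf with hf | hf
      · exact ⟨ne_of_mem_of_not_mem (h1.src_mem hf) h3.1,
          ne_of_mem_of_not_mem (tgt_mem hf) h3.1⟩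
      · exact ⟨ne_of_mem_of_not_mem (h2.src_mem hf) h3.2,
          ne_of_mem_of_not_mem (tgt_mem hf) h3.2⟩
    · intro f hf
      have := hCE f hf
      simp only [List.mem_append] at this ⊢
      tauto
  obtain ⟨e0, he0⟩ := List.exists_mem_of_ne_nil F hF0
  have hFnot : F.toFinset ∉ 𝒟 := fun h =>
    hnd' e0 he0 (((h𝒟 _).1 h).2 e0 (List.mem_toFinset.2 he0))
  refine ⟨insert F.toFinset 𝒟, fun C => ?_, ?_, ?_⟩
  · rw [Finset.mem_insert, h𝒟]
    constructor
    · rintro (rfl | ⟨hC, hCE⟩)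
      · exact ⟨hFcyc, fun e he => List.mem_append_left _
          (List.mem_append_right _ (List.mem_toFinset.1 he))⟩
      · exact ⟨hC, fun e he => hsub.subset (hCE e he)⟩
    · rintro ⟨hC, hCE⟩
      by_cases hmeet : ∃ e ∈ F, e ∈ C
      · obtain ⟨e, heF, heC⟩ := hmeet
        exact Or.inl (huniq C hC hCE e heF heC)
      · push Not at hmeet
        refine Or.inr ⟨hC, fun e he => ?_⟩
        have h3 := hCE e he
        have h4 : e ∉ F := fun h => hmeet e h he
        simp only [List.mem_append] at h3 ⊢
        tauto
  · have hcross : ∀ C ∈ 𝒟, ∀ e ∈ C, e ∉ F.toFinset := fun C hC e he heF =>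
      hnd' e (List.mem_toFinset.1 heF) (((h𝒟 _).1 hC).2 e he)
    intro C hC C' hC' e he he'
    rcases Finset.mem_insert.1 hC with rfl | hC <;> rcases Finset.mem_insert.1 hC' with rfl | hC'
    · rfl
    · exact absurd he (hcross _ hC' e he')
    · exact absurd he' (hcross _ hC e he)
    · exact hdisj C hC C' hC' e he he'
  · rw [Finset.prod_insert hFnot, Complex.ofReal_mul,
      List.toFinset_card_of_nodup (List.Nodup.of_map tgt hFnd)]
    exact tendsto_graphSum_insert_cycle hS x F src tgt l1 l2 y _ hF0 h1 hF h2 hFnd hnew hlim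

end NonCrossing

/-! ### Partitions and closed walks -/

section Partitions

variable {k : ℕ} (π : SetPartition k)

/-- The block of `i`, as an element of the type of blocks. -/
def block (i : Fin k) : {B : Finset (Fin k) // B ∈ π.parts} :=
  ⟨π.part i, π.part_mem.2 (Finset.mem_univ i)⟩

theorem block_eq_iff {i j : Fin k} : block π i = block π j ↔ π.part i = π.part j := by
  simp [block]

theorem block_surjective : Function.Surjective (block π) := by
  rintro ⟨B, hB⟩
  obtain ⟨i, hi⟩ := π.nonempty_of_mem_parts hB
  exact ⟨i, Subtype.ext (π.part_eq_of_mem hB hi)⟩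

/-- The maps whose fibres are the blocks of `π` are those which take equal values exactly on points
of the same block. -/
theorem mem_labelings_iff {n : ℕ} {a : Fin k → Fin n} :
    a ∈ labelings n π ↔ ∀ i j, a i = a j ↔ π.part i = π.part j := by
  have hpart : ∀ i j, j ∈ π.part i ↔ π.part i = π.part j := fun i j => by
    rw [π.mem_part_iff_part_eq_part (Finset.mem_univ _) (Finset.mem_univ _), eq_comm]
  simp only [labelings, Finset.mem_filter, Finset.mem_univ, true_and]
  constructor
  · intro h i j
    have h1 : ({j | a j = a i} : Finset (Fin k)) ∈ π.parts := by
      rw [← h]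
      exact Finset.mem_image_of_mem _ (Finset.mem_univ i)
    have h2 := π.part_eq_of_mem h1 (a := i) (by simp)
    rw [← hpart, h2]
    simp [eq_comm]
  · intro h
    have h1 : ∀ i, ({j | a j = a i} : Finset (Fin k)) = π.part i := by
      intro i
      ext j
      rw [hpart, ← h i j]
      simp [eq_comm]
    simp only [h1]
    ext B
    simp only [Finset.mem_image, Finset.mem_univ, true_and]
    constructor
    · rintro ⟨i, rfl⟩
      exact π.part_mem.2 (Finset.mem_univ i)
    · intro hB
      obtain ⟨i, hi⟩ := π.nonempty_of_mem_parts hB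
      exact ⟨i, π.part_eq_of_mem hB hi⟩

theorem sum_labelings {n : ℕ} (f : (Fin k → Fin n) → ℂ) :
    open Classical in
    ∑ a ∈ labelings n π, f a = ∑ a : {B : Finset (Fin k) // B ∈ π.parts} → Fin n,
      if Set.InjOn a ((Finset.univ : Finset {B : Finset (Fin k) // B ∈ π.parts}) : Set _) then
        f (a ∘ block π) else 0 := by
  classical
  rw [← Finset.sum_filter]
  symm
  refine Finset.sum_bij (fun a _ => a ∘ block π) ?_ ?_ ?_ ?_
  · intro a ha
    rw [Finset.mem_filter, Finset.coe_univ, Set.injOn_univ] at ha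
    rw [mem_labelings_iff]
    intro i j
    rw [Function.comp_apply, Function.comp_apply, ha.2.eq_iff, block_eq_iff]
  · intro a _ b _ h
    exact (block_surjective π).injective_comp_right h
  · intro b hb
    rw [mem_labelings_iff] at hb
    have hsec := Function.surjInv_eq (block_surjective π)
    refine ⟨b ∘ Function.surjInv (block_surjective π), ?_, ?_⟩
    · rw [Finset.mem_filter, Finset.coe_univ, Set.injOn_univ]
      refine ⟨Finset.mem_univ _, fun B B' h => ?_⟩
      have h1 := (hb _ _).1 h
      rw [← block_eq_iff, hsec, hsec] at h1
      exact h1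
    · funext i
      exact (hb _ _).2 ((block_eq_iff π).1 (hsec _))
  · intro a _
    rfl

/-- The cyclic sum of `S` over a partition `π` is the graph sum of `S / √n` over the closed walk
through the blocks of `π`. -/
theorem cyclicSum_eq_graphSum {n : ℕ} (hn : 0 < n) (S : Matrix (Fin n) (Fin n) ℂ) :
    cyclicSum S π = graphSum (((1 / √(n : ℝ) : ℝ) : ℂ) • S) (block π)
      (fun i => block π (finRotate k i)) Finset.univ (List.finRange k) := by
  classical
  have hn' : (0 : ℝ) < n := by exact_mod_cast hn
  have hnc : (n : ℂ) ≠ 0 := by exact_mod_cast hn.ne'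
  unfold cyclicSum graphSum
  rw [sum_labelings]
  rw [Finset.card_univ, div_right_comm, div_self (pow_ne_zero _ hnc)]
  have hpow : (n : ℝ) ^ ((k : ℝ) / 2 + 1) = √n ^ k * n := by
    rw [Real.rpow_add hn', Real.rpow_one, Real.sqrt_eq_rpow, ← Real.rpow_natCast,
      ← Real.rpow_mul hn'.le]
    congr 2
    ring
  rw [hpow, Finset.mul_sum, Finset.mul_sum]
  refine Finset.sum_congr rfl fun a _ => ?_
  split_ifs
  · rw [← Fin.prod_univ_def]
    simp only [Matrix.smul_apply, smul_eq_mul, Finset.prod_mul_distrib, Finset.prod_const,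
      Finset.card_univ, Fintype.card_fin, Function.comp_apply]
    push_cast
    field_simp
    rw [div_pow, one_pow]
    ring
  · simp

theorem isUnderlying_partitionGraph :
    IsUnderlying (partitionGraph π) (Subtype.val ∘ block π)
      (Subtype.val ∘ fun i => block π (finRotate k i)) :=
  fun _ _ _ => Iff.rfl

theorem IsWalk.of_getElem {α β : Type*} {src tgt : β → α} {x y : α} {E : List β}
    (h0 : ∀ h : 0 < E.length, src E[0] = x)
    (hs : ∀ (i : ℕ) (h : i + 1 < E.length), src E[i + 1] = tgt E[i])
    (hl : ∀ (i : ℕ) (h : i + 1 = E.length), tgt E[i] = y) (hE : E ≠ []) :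
    IsWalk src tgt x E y := by
  induction E generalizing x with
  | nil => exact absurd rfl hE
  | cons e E ih =>
    refine ⟨by simpa using h0, ?_⟩
    by_cases hE : E = []
    · subst hE
      simpa using hl 0
    · refine ih (fun h => by simpa using hs 0 (by simpa using h)) (fun i h => ?_) (fun i h => ?_) hE
      · exact hs (i + 1) (by simpa using h)
      · simpa using hl (i + 1) (by simpa using h)

theorem finRotate_of_succ_lt {i : ℕ} (h : i + 1 < k) :
    finRotate k ⟨i, by omega⟩ = ⟨i + 1, h⟩ := by
  apply Fin.ext
  rw [val_finRotate]
  simp [h.ne]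

theorem finRotate_of_succ_eq {i : ℕ} (h : i + 1 = k) (hk : 0 < k) :
    finRotate k ⟨i, by omega⟩ = ⟨0, hk⟩ := by
  apply Fin.ext
  rw [val_finRotate]
  simp [h]

theorem isWalk_finRange (hk : 0 < k) :
    IsWalk (block π) (fun i => block π (finRotate k i)) (block π ⟨0, hk⟩) (List.finRange k)
      (block π ⟨0, hk⟩) := by
  refine IsWalk.of_getElem (fun h => by simp) (fun i h => ?_) (fun i h => ?_) (by simp; omega)
  · simp only [List.getElem_finRange, Fin.cast_mk]
    rw [finRotate_of_succ_lt (by simpa using h)]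
  · simp only [List.getElem_finRange, Fin.cast_mk]
    rw [finRotate_of_succ_eq (by simpa using h)]

theorem walkWord_finRange (hk : 0 < k) :
    walkWord (fun i => block π (finRotate k i)) (block π ⟨0, hk⟩) (List.finRange k) =
      (List.finRange k).map (block π) ++ [block π ⟨0, hk⟩] := by
  apply List.ext_getElem
  · simp [walkWord]
  · intro i h1 h2
    have hi : i ≤ k := by simp [walkWord] at h1; omega
    rcases i with _ | i
    · rw [List.getElem_append_left (by simpa using hk)]
      simp [walkWord]
    · rcases hi.lt_or_eq with h | h
      · rw [List.getElem_append_left (by simpa using h)]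
        simp only [walkWord, List.getElem_cons_succ, List.getElem_map, List.getElem_finRange,
          Fin.cast_mk]
        rw [finRotate_of_succ_lt h]
      · rw [List.getElem_append_right (by simp [h])]
        simp only [walkWord, List.getElem_cons_succ, List.getElem_map, List.getElem_finRange,
          Fin.cast_mk]
        rw [finRotate_of_succ_eq h hk]
        simp

/-- The word of the closed walk repeats its first letter at its end, which creates no new crossing
patterns. -/
theorem crossing_iff_not_isNonCrossing (hk : 0 < k) :
    Crossing (walkWord (fun i => block π (finRotate k i)) (block π ⟨0, hk⟩) (List.finRange k)) ↔
      ¬ IsNonCrossing π := by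
  have hsorted : (List.finRange k).Pairwise (· < ·) := List.pairwise_lt_finRange k
  rw [walkWord_finRange]
  constructor
  · rintro ⟨A, B, hAB, hs⟩ hnc
    obtain ⟨r, r', hr, h1, h2⟩ := List.sublist_append_iff.1 hs
    obtain ⟨l, hl, rfl⟩ := List.sublist_map_iff.1 h1
    have hlp := hsorted.sublist hl
    rcases List.sublist_singleton.1 h2 with rfl | rfl
    · rw [List.append_nil] at hr
      obtain ⟨a, b, c, d, rfl⟩ : ∃ a b c d, l = [a, b, c, d] :=
        List.length_eq_four.1 (by simpa using (congrArg List.length hr).symm)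
      simp only [List.map_cons, List.map_nil, List.cons.injEq, and_true] at hr
      obtain ⟨rfl, rfl, h3, h4⟩ := hr
      simp at hlp
      exact hAB ((block_eq_iff π).2 (hnc a b c d (by tauto) (by tauto) (by tauto)
        ((block_eq_iff π).1 h3) ((block_eq_iff π).1 h4)))
    · -- the last letter of the word is also its first one
      obtain ⟨a, b, c, rfl⟩ : ∃ a b c, l = [a, b, c] := by
        refine List.length_eq_three.1 ?_
        have := congrArg List.length hr
        simp at this
        omega
      simp only [List.map_cons, List.map_nil, List.cons_append, List.nil_append, List.cons.injEq,
        and_true] at hr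
      obtain ⟨rfl, rfl, h3, h4⟩ := hr
      simp at hlp
      have ha : (⟨0, hk⟩ : Fin k) < a := by
        rw [Fin.lt_def]
        refine Nat.pos_of_ne_zero fun h => hAB ?_
        rw [h4]
        congr 1
        exact Fin.ext h
      have h5 := hnc _ a b c ha (by tauto) (by tauto) ((block_eq_iff π).1 h4.symm)
        ((block_eq_iff π).1 h3)
      exact hAB (h4.trans ((block_eq_iff π).2 h5)).symm
  · intro h
    simp only [IsNonCrossing] at h
    push Not at h
    obtain ⟨a, b, c, d, hab, hbc, hcd, hac, hbd, hne⟩ := h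
    have hl : [a, b, c, d].Sublist (List.finRange k) := by
      refine List.sublist_of_subperm_of_pairwise (r := (· < ·)) ?_ ?_ hsorted
      · refine List.Nodup.subperm ?_ (fun x _ => List.mem_finRange x)
        simp [hab.ne, hbc.ne, hcd.ne, (hab.trans hbc).ne, (hbc.trans hcd).ne,
          (hab.trans (hbc.trans hcd)).ne]
      · simp [hab, hbc, hcd, hab.trans hbc, hbc.trans hcd, hab.trans (hbc.trans hcd)]
    have h2 := hl.map (block π)
    simp only [List.map_cons, List.map_nil] at h2
    rw [← (block_eq_iff π).2 hac, ← (block_eq_iff π).2 hbd] at h2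
    exact ⟨_, _, fun h => hne ((block_eq_iff π).1 h), h2.trans (List.sublist_append_left _ _)⟩

theorem toFinset_walkWord_finRange (hk : 0 < k) :
    (walkWord (fun i => block π (finRotate k i)) (block π ⟨0, hk⟩) (List.finRange k)).toFinset =
      Finset.univ := by
  rw [walkWord_finRange]
  ext B
  obtain ⟨i, rfl⟩ := block_surjective π B
  simp

variable {n : ℕ → ℕ} {S : ∀ N, Matrix (Fin (n N)) (Fin (n N)) ℂ} {s : ℝ}

theorem tendsto_cyclicSum_of_crossing
    (hS : IsScaledConferenceSeq (fun N => ((1 / √(n N : ℝ) : ℝ) : ℂ) • S N) s) (hk : 0 < k)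
    (hπ : ¬ IsNonCrossing π) :
    Tendsto (fun N => cyclicSum (S N) π) atTop (𝓝 0) := by
  have h := tendsto_graphSum_of_crossing hS (block π) (fun i => block π (finRotate k i))
    (block π ⟨0, hk⟩) (List.finRange k) (isWalk_finRange π hk)
    ((crossing_iff_not_isNonCrossing π hk).2 hπ)
  rw [toFinset_walkWord_finRange] at h
  refine h.congr' ?_
  filter_upwards [hS.size.eventually_gt_atTop 0] with N hN
  exact (cyclicSum_eq_graphSum π hN (S N)).symm

theorem tendsto_cyclicSum_of_isNonCrossing
    (hS : IsScaledConferenceSeq (fun N => ((1 / √(n N : ℝ) : ℝ) : ℂ) • S N) s) (hk : 0 < k)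
    (hπ : IsNonCrossing π) :
    (∀ C ∈ simpleCycles π, ∀ C' ∈ simpleCycles π, ∀ e ∈ C, e ∈ C' → C = C') ∧
    Tendsto (fun N => cyclicSum (S N) π) atTop
      (𝓝 ((∏ C ∈ simpleCycles π, cycleWeight s C.card : ℝ) : ℂ)) := by
  obtain ⟨𝒟, h𝒟, hdisj, h⟩ := exists_cycles_of_not_crossing hS Subtype.val_injective (block π)
    (fun i => block π (finRotate k i)) (isUnderlying_partitionGraph π)
    (block π ⟨0, hk⟩) (List.finRange k) (isWalk_finRange π hk) (List.nodup_finRange k)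
    (fun hc => (crossing_iff_not_isNonCrossing π hk).1 hc hπ)
  have hD : simpleCycles π = 𝒟 := by
    ext C
    rw [h𝒟]
    simp [simpleCycles]
  rw [hD]
  refine ⟨hdisj, ?_⟩
  rw [toFinset_walkWord_finRange] at h
  refine h.congr' ?_
  filter_upwards [hS.size.eventually_gt_atTop 0] with N hN
  exact (cyclicSum_eq_graphSum π hN (S N)).symm

/-- A partition of the edges of `G_π` into simple cycles consists of all the simple cycles. -/
theorem parts_eq_simpleCycles
    (hdisj : ∀ C ∈ simpleCycles π, ∀ C' ∈ simpleCycles π, ∀ e ∈ C, e ∈ C' → C = C')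
    (D : Finpartition (Finset.univ : Finset (Fin k)))
    (hD : ∀ C ∈ D.parts, IsSimpleCycle (partitionGraph π) C) : D.parts = simpleCycles π := by
  have hsub : ∀ C ∈ D.parts, C ∈ simpleCycles π := fun C hC => by
    simpa [simpleCycles] using hD C hC
  refine Finset.Subset.antisymm hsub fun C hC => ?_
  have hC' : IsSimpleCycle (partitionGraph π) C := by simpa [simpleCycles] using hC
  obtain ⟨l, v, g, hl, -, -, -, hCg⟩ := hC'
  have he : g ⟨0, hl⟩ ∈ (C : Set (Fin k)) := hCg ▸ Set.mem_range_self _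
  have hp := D.part_mem.2 (Finset.mem_univ (g ⟨0, hl⟩))
  rw [hdisj C hC _ (hsub _ hp) _ he (D.mem_part_self.2 (Finset.mem_univ _))]
  exact hp

end Partitions

/-! ### Equiangular tight frames -/

section Frames

variable {m n : ℕ} {F : Matrix (Fin m) (Fin n) ℂ}

theorem IsUnitNormETF.gram_diag (hF : IsUnitNormETF F) (i : Fin n) : (Fᴴ * F) i i = 1 := by
  rw [Matrix.mul_apply]
  have h : ∀ j, Fᴴ i j * F j i = ((‖F j i‖ ^ 2 : ℝ) : ℂ) := fun j => by
    rw [Matrix.conjTranspose_apply, Complex.ofReal_pow]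
    exact Complex.conj_mul' _
  simp only [h]
  rw [← Complex.ofReal_sum, hF.unit_norm, Complex.ofReal_one]

theorem gram_apply_swap (F : Matrix (Fin m) (Fin n) ℂ) (i j : Fin n) :
    (Fᴴ * F) j i = star ((Fᴴ * F) i j) :=
  ((Matrix.isHermitian_conjTranspose_mul_self F).apply j i).symm

/-- The Gram matrix of a unit norm tight frame is `n / m` times a projection; the constant is found
by comparing the traces of `F F*` and `F* F`. -/
theorem IsUnitNormETF.gram_sq (hF : IsUnitNormETF F) (hm : 0 < m) (hn : 0 < n) :
    (Fᴴ * F) * (Fᴴ * F) = (((aspectRatio m n)⁻¹ : ℝ) : ℂ) • (Fᴴ * F) := by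
  obtain ⟨a, -, ha⟩ := hF.tight
  have hm' : (m : ℝ) ≠ 0 := by exact_mod_cast hm.ne'
  have hn' : (n : ℝ) ≠ 0 := by exact_mod_cast hn.ne'
  have htr : (a : ℂ) * m = n := by
    have h1 : (F * Fᴴ).trace = (Fᴴ * F).trace := Matrix.trace_mul_comm _ _
    rw [ha, Matrix.trace_smul, Matrix.trace_one, Fintype.card_fin, smul_eq_mul] at h1
    rw [h1, Matrix.trace]
    simp [hF.gram_diag]
  have htr' : a * m = n := by exact_mod_cast htr
  have ha' : a = (aspectRatio m n)⁻¹ := by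
    rw [aspectRatio, inv_div, ← htr']
    field_simp
  rw [← ha', Matrix.mul_assoc, ← Matrix.mul_assoc F, ha, Matrix.smul_mul, Matrix.one_mul,
    Matrix.mul_smul]

/-- The off-diagonal entries of the Gram matrix have squared modulus `x / (n - 1)`, by comparison of
the diagonal entries of its square. -/
theorem IsUnitNormETF.norm_gram_sq (hF : IsUnitNormETF F) (hm : 0 < m) (hn : 2 ≤ n) {i j : Fin n}
    (hij : i ≠ j) : ‖(Fᴴ * F) i j‖ ^ 2 = ratioParam (aspectRatio m n) / (n - 1) := by
  obtain ⟨c, hc⟩ := hF.equiangular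
  have hsq := congrFun (congrFun (hF.gram_sq hm (by omega)) i) i
  rw [Matrix.mul_apply, Matrix.smul_apply, hF.gram_diag, smul_eq_mul, mul_one] at hsq
  have h : ∀ l, (Fᴴ * F) i l * (Fᴴ * F) l i = ((if l = i then 1 else c ^ 2 : ℝ) : ℂ) := fun l => by
    split_ifs with h
    · subst h; simp [hF.gram_diag]
    · rw [gram_apply_swap F i l, ← hc i l (Ne.symm h), Complex.ofReal_pow]
      exact Complex.mul_conj' _
  simp only [h] at hsq
  rw [← Complex.ofReal_sum, Complex.ofReal_inj, ← Finset.add_sum_erase _ _ (Finset.mem_univ i),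
    if_pos rfl, Finset.sum_congr rfl (g := fun _ => c ^ 2)
      (fun l hl => if_neg (Finset.ne_of_mem_erase hl)), Finset.sum_const,
    Finset.card_erase_of_mem (Finset.mem_univ i), Finset.card_univ, Fintype.card_fin,
    nsmul_eq_mul, Nat.cast_sub (by omega), Nat.cast_one] at hsq
  have hn1 : (n : ℝ) - 1 ≠ 0 := by
    have : (2 : ℝ) ≤ n := by exact_mod_cast hn
    linarith
  rw [hc i j hij, ratioParam, eq_div_iff hn1]
  linarith

theorem conferenceMatrix_apply_ne {i j : Fin n} (hij : i ≠ j) :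
    conferenceMatrix F i j =
      ((√(((n : ℝ) - 1) / ratioParam (aspectRatio m n)) : ℝ) : ℂ) * (Fᴴ * F) i j := by
  simp [conferenceMatrix, hij]

/-- The generalized conference matrix divided by `√n` is a scaled conference matrix. -/
theorem IsUnitNormETF.isScaledConference (hF : IsUnitNormETF F) (hn : 2 ≤ n)
    (hγ0 : 0 < aspectRatio m n) (hγ1 : aspectRatio m n < 1) :
    IsScaledConference (((1 / √(n : ℝ) : ℝ) : ℂ) • conferenceMatrix F)
      ((√(((n : ℝ) - 1) / n) * diagParam (aspectRatio m n) : ℝ) : ℂ) := by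
  have hm : 0 < m := by
    refine Nat.pos_of_ne_zero fun h => ?_
    simp [aspectRatio, h] at hγ0
  have hn0 : (0 : ℝ) < n := by positivity
  have hn1 : (0 : ℝ) < (n : ℝ) - 1 := by
    have : (2 : ℝ) ≤ n := by exact_mod_cast hn
    linarith
  have hx : 0 < ratioParam (aspectRatio m n) := by
    rw [ratioParam, sub_pos]
    exact (one_lt_inv₀ hγ0).2 hγ1
  set γ := aspectRatio m n with hγ
  set x := ratioParam γ with hxdef
  have hhalf : 1 / (2 * γ) = (x + 1) / 2 := by
    rw [hxdef, ratioParam]; field_simp; ring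
  have hnorm : ∀ i j, i ≠ j →
      ‖(((1 / √(n : ℝ) : ℝ) : ℂ) • conferenceMatrix F) i j‖ ^ 2 = 1 / n := by
    intro i j hij
    rw [Matrix.smul_apply, conferenceMatrix_apply_ne hij, smul_eq_mul, norm_mul, norm_mul,
      mul_pow, mul_pow, hF.norm_gram_sq hm hn hij, Complex.norm_real, Complex.norm_real,
      Real.norm_eq_abs, Real.norm_eq_abs, sq_abs, sq_abs, div_pow, Real.sq_sqrt hn0.le,
      Real.sq_sqrt (by positivity), ← hγ, ← hxdef]
    field_simp
  refine ⟨fun i => ?_, fun i j hij => ?_, hnorm, fun i j hij => ?_⟩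
  · rw [Matrix.smul_apply, conferenceMatrix, Matrix.smul_apply, Matrix.sub_apply, hF.gram_diag,
      Matrix.smul_apply, Matrix.one_apply_eq, ← hγ, ← hxdef, hhalf, diagParam, ← hxdef,
      Real.sqrt_div hn1.le, Real.sqrt_div hn1.le]
    simp only [smul_eq_mul, mul_one]
    push_cast
    have h1 : (√(n : ℝ) : ℂ) ≠ 0 := by exact_mod_cast (Real.sqrt_pos.2 hn0).ne'
    have h2 : (√x : ℂ) ≠ 0 := by exact_mod_cast (Real.sqrt_pos.2 hx).ne'
    field_simp
    ring
  · have h1 : (((1 / √(n : ℝ) : ℝ) : ℂ) • conferenceMatrix F) j i =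
        star ((((1 / √(n : ℝ) : ℝ) : ℂ) • conferenceMatrix F) i j) := by
      rw [Matrix.smul_apply, Matrix.smul_apply, conferenceMatrix_apply_ne hij,
        conferenceMatrix_apply_ne hij.symm, gram_apply_swap F i j]
      simp
    rw [h1]
    have h2 := hnorm i j hij
    rw [← Complex.normSq_eq_norm_sq] at h2
    have h3 := Complex.mul_conj ((((1 / √(n : ℝ) : ℝ) : ℂ) • conferenceMatrix F) i j)
    rw [h2] at h3
    simpa using h3
  · -- `2 h = 1 / γ`, so `(F* F - h I) ^ 2` is a multiple of the identity
    have hsq : conferenceMatrix F * conferenceMatrix F =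
        (((√(((n : ℝ) - 1) / x) : ℝ) : ℂ) ^ 2 * ((1 / (2 * γ) : ℝ) : ℂ) ^ 2) •
          (1 : Matrix (Fin n) (Fin n) ℂ) := by
      have hinv : ((γ⁻¹ : ℝ) : ℂ) = 2 * ((1 / (2 * γ) : ℝ) : ℂ) := by
        push_cast
        have : (γ : ℂ) ≠ 0 := by exact_mod_cast hγ0.ne'
        field_simp
      have h1 := hF.gram_sq hm (by omega)
      rw [← hγ, hinv] at h1
      unfold conferenceMatrix
      rw [← hγ, ← hxdef, Matrix.smul_mul, Matrix.mul_smul, smul_smul, Matrix.sub_mul,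
        Matrix.mul_sub, Matrix.mul_sub, h1]
      simp only [Matrix.smul_mul, Matrix.mul_smul, Matrix.one_mul, Matrix.mul_one]
      module
    have h2 : ∑ l, (((1 / √(n : ℝ) : ℝ) : ℂ) • conferenceMatrix F) i l *
        (((1 / √(n : ℝ) : ℝ) : ℂ) • conferenceMatrix F) l j =
        ((((1 / √(n : ℝ) : ℝ) : ℂ) • conferenceMatrix F) *
        (((1 / √(n : ℝ) : ℝ) : ℂ) • conferenceMatrix F)) i j := (Matrix.mul_apply ..).symm
    rw [h2, Matrix.smul_mul, Matrix.mul_smul, hsq]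
    simp [hij]

theorem continuousAt_ratioParam {γ : ℝ} (hγ0 : 0 < γ) : ContinuousAt ratioParam γ :=
  (continuousAt_inv₀ hγ0.ne').sub continuousAt_const

theorem ratioParam_pos {γ : ℝ} (hγ0 : 0 < γ) (hγ1 : γ < 1) : 0 < ratioParam γ :=
  sub_pos.2 ((one_lt_inv₀ hγ0).2 hγ1)

theorem tendsto_sub_one_div {n : ℕ → ℕ} (hn : Tendsto n atTop atTop) :
    Tendsto (fun N => ((n N : ℝ) - 1) / n N) atTop (𝓝 1) := by
  have h1 : Tendsto (fun N => (1 : ℝ) / (n N : ℝ)) atTop (𝓝 0) :=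
    (tendsto_const_div_atTop_nhds_zero_nat (𝕜 := ℝ) 1).comp hn
  have h2 := (tendsto_const_nhds (x := (1 : ℝ))).sub h1
  rw [sub_zero] at h2
  refine h2.congr' ?_
  filter_upwards [hn.eventually_gt_atTop 0] with N hN
  have : (n N : ℝ) ≠ 0 := by exact_mod_cast hN.ne'
  field_simp

theorem isScaledConferenceSeq {γ : ℝ} (hγ0 : 0 < γ) (hγ1 : γ < 1) {m n : ℕ → ℕ}
    {F : ∀ N : ℕ, Matrix (Fin (m N)) (Fin (n N)) ℂ} (hF : ∀ N, IsUnitNormETF (F N))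
    (hn : Tendsto n atTop atTop)
    (hmn : Tendsto (fun N => aspectRatio (m N) (n N)) atTop (𝓝 γ)) :
    IsScaledConferenceSeq (fun N => ((1 / √(n N : ℝ) : ℝ) : ℂ) • conferenceMatrix (F N))
      (diagParam γ) := by
  refine ⟨hn, fun N => ((√(((n N : ℝ) - 1) / n N) * diagParam (aspectRatio (m N) (n N)) : ℝ) : ℂ),
    ?_, ?_⟩
  · have hx := ratioParam_pos hγ0 hγ1
    have hc : ContinuousAt diagParam γ := by
      have h1 := continuousAt_ratioParam hγ0
      refine (continuousAt_const.sub h1).div (continuousAt_const.mul h1.sqrt) ?_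
      have := Real.sqrt_pos.2 hx
      positivity
    have h2 := (tendsto_sub_one_div hn).sqrt.mul (hc.tendsto.comp hmn)
    rw [Real.sqrt_one, one_mul] at h2
    exact (Complex.continuous_ofReal.tendsto _).comp h2
  · filter_upwards [hn.eventually_ge_atTop 2, hmn.eventually_const_lt hγ0,
      hmn.eventually_lt_const hγ1] with N h1 h2 h3
    exact (hF N).isScaledConference h1 h2 h3

end Frames

/-! ### Traces and moments -/

section Traces

/-- The entries of `M ^ k` are sums over walks with `k` steps; the weight `Φ` of the end points is
there to make the induction go through. -/
theorem sum_path {ι : Type*} [Fintype ι] [DecidableEq ι] (M : Matrix ι ι ℂ) (k : ℕ)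
    (Φ : ι → ι → ℂ) :
    ∑ a : Fin (k + 1) → ι, (∏ r : Fin k, M (a r.castSucc) (a r.succ)) * Φ (a 0) (a (Fin.last k)) =
      ∑ i, ∑ j, (M ^ k) i j * Φ i j := by
  induction k generalizing Φ with
  | zero =>
    rw [← (Equiv.funUnique (Fin 1) ι).symm.sum_comp]
    simp [Matrix.one_apply]
  | succ k ih =>
    rw [← (Fin.consEquiv fun _ : Fin (k + 2) => ι).sum_comp, Fintype.sum_prod_type]
    refine Finset.sum_congr rfl fun x _ => ?_
    have h := ih fun i j => M x i * Φ x j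
    calc _ = ∑ b : Fin (k + 1) → ι, (∏ r : Fin k, M (b r.castSucc) (b r.succ)) *
          (M x (b 0) * Φ x (b (Fin.last k))) := by
          refine Finset.sum_congr rfl fun b _ => ?_
          rw [Fin.prod_univ_succ]
          simp only [Fin.consEquiv_apply, Fin.castSucc_zero, Fin.cons_zero, Fin.cons_succ,
            ← Fin.succ_castSucc, ← Fin.succ_last]
          ring
      _ = ∑ i, ∑ j, (M ^ k) i j * (M x i * Φ x j) := h
      _ = ∑ j, (M ^ (k + 1)) x j * Φ x j := by
          rw [Finset.sum_comm]
          refine Finset.sum_congr rfl fun j _ => ?_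
          rw [pow_succ', Matrix.mul_apply, Finset.sum_mul]
          refine Finset.sum_congr rfl fun i _ => ?_
          ring

/-- The trace of a power of a matrix as a sum over closed walks. -/
theorem trace_pow_eq_sum {ι : Type*} [Fintype ι] [DecidableEq ι] (M : Matrix ι ι ℂ) {k : ℕ}
    (hk : 0 < k) : (M ^ k).trace = ∑ a : Fin k → ι, ∏ i, M (a i) (a (finRotate k i)) := by
  obtain ⟨k, rfl⟩ := Nat.exists_eq_add_of_le' hk
  have h := sum_path M k fun i j => M j i
  have h1 : ∀ a : Fin (k + 1) → ι, ∏ i, M (a i) (a (finRotate (k + 1) i)) =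
      (∏ r : Fin k, M (a r.castSucc) (a r.succ)) * M (a (Fin.last k)) (a 0) := by
    intro a
    rw [Fin.prod_univ_castSucc, finRotate_last]
    congr 1
    refine Finset.prod_congr rfl fun r _ => ?_
    congr 2
    apply Fin.ext
    rw [val_finRotate]
    simp [r.isLt.ne]
  simp only [h1]
  rw [h, pow_succ, Matrix.trace]
  simp only [Matrix.diag_apply, Matrix.mul_apply]

end Traces

section Expectation

variable {n : ℕ} {p : ℝ}

theorem bernoulliExpect_sum {ι : Type*} (s : Finset ι) (f : ι → Finset (Fin n) → ℂ) :
    bernoulliExpect n p (fun T => ∑ i ∈ s, f i T) = ∑ i ∈ s, bernoulliExpect n p (f i) := by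
  simp only [bernoulliExpect, Finset.mul_sum]
  exact Finset.sum_comm

theorem bernoulliExpect_add (f g : Finset (Fin n) → ℂ) :
    bernoulliExpect n p (fun T => f T + g T) =
      bernoulliExpect n p f + bernoulliExpect n p g := by
  simp only [bernoulliExpect, mul_add, Finset.sum_add_distrib]

theorem bernoulliExpect_mul (c : ℂ) (f : Finset (Fin n) → ℂ) :
    bernoulliExpect n p (fun T => c * f T) = c * bernoulliExpect n p f := by
  simp only [bernoulliExpect, Finset.mul_sum]
  exact Finset.sum_congr rfl fun T _ => by ring

/-- The random set contains a given set `A` with probability `p ^ |A|`. -/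
theorem bernoulliExpect_subset (A : Finset (Fin n)) (c : ℂ) :
    bernoulliExpect n p (fun T => if A ⊆ T then c else 0) = (p : ℂ) ^ A.card * c := by
  have key : ∑ T : Finset (Fin n), (if A ⊆ T then p ^ T.card * (1 - p) ^ (n - T.card) else 0) =
      p ^ A.card := by
    have h := Finset.prod_add (fun _ : Fin n => p) (fun i => if i ∈ A then 0 else 1 - p)
      Finset.univ
    have h1 : ∏ i : Fin n, (p + if i ∈ A then 0 else 1 - p) = p ^ A.card := by
      rw [Finset.prod_congr rfl (g := fun i => if i ∈ A then p else 1)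
        (fun i _ => by split_ifs <;> ring), Finset.prod_ite_mem, Finset.univ_inter,
        Finset.prod_const]
    rw [h1, Finset.powerset_univ] at h
    rw [h]
    refine Finset.sum_congr rfl fun T _ => ?_
    rw [Finset.prod_const]
    split_ifs with hA
    · rw [Finset.prod_congr rfl (g := fun _ => 1 - p), Finset.prod_const,
        ← Finset.compl_eq_univ_sdiff, Finset.card_compl, Fintype.card_fin]
      intro i hi
      rw [Finset.mem_sdiff] at hi
      exact if_neg fun h => hi.2 (hA h)
    · obtain ⟨i, hiA, hiT⟩ := Finset.not_subset.1 hA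
      have h0 : ∏ i ∈ Finset.univ \ T, (if i ∈ A then 0 else 1 - p) = 0 :=
        Finset.prod_eq_zero (Finset.mem_sdiff.2 ⟨Finset.mem_univ i, hiT⟩) (if_pos hiA)
      rw [h0, mul_zero]
  rw [← Complex.ofReal_pow, ← key, Complex.ofReal_sum, Finset.sum_mul, bernoulliExpect]
  refine Finset.sum_congr rfl fun T _ => ?_
  split_ifs <;> simp

end Expectation

section Moments

variable {n : ℕ} {p : ℝ}

theorem prod_selection {k : ℕ} (S : Matrix (Fin n) (Fin n) ℂ) (T : Finset (Fin n))
    (a : Fin k → Fin n) :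
    ∏ i, (selection T * S * selection T) (a i) (a (finRotate k i)) =
      if Finset.univ.image a ⊆ T then ∏ i, S (a i) (a (finRotate k i)) else 0 := by
  have hent : ∀ i j, (selection T * S * selection T) i j =
      (if i ∈ T then 1 else 0) * S i j * if j ∈ T then 1 else 0 := by
    intro i j
    rw [selection, Matrix.mul_diagonal, Matrix.diagonal_mul]
  split_ifs with h
  · have h' : ∀ i, a i ∈ T := fun i => h (Finset.mem_image_of_mem _ (Finset.mem_univ i))
    exact Finset.prod_congr rfl fun i _ => by rw [hent, if_pos (h' _), if_pos (h' _)]; ring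
  · obtain ⟨y, hy, hyT⟩ := Finset.not_subset.1 h
    obtain ⟨i, -, rfl⟩ := Finset.mem_image.1 hy
    exact Finset.prod_eq_zero (Finset.mem_univ i) (by rw [hent, if_neg hyT]; ring)

theorem card_image_of_mem_labelings {k : ℕ} {π : SetPartition k} {a : Fin k → Fin n}
    (ha : a ∈ labelings n π) : (Finset.univ.image a).card = π.parts.card := by
  have h : Finset.univ.image (fun i => ({j | a j = a i} : Finset (Fin k))) = π.parts := by
    simpa [labelings] using ha
  have h1 : π.parts = (Finset.univ.image a).image
      (fun y => ({j | a j = y} : Finset (Fin k))) := by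
    rw [← h, Finset.image_image]
    rfl
  rw [h1]
  refine (Finset.card_image_of_injOn ?_).symm
  intro y hy z _ hyz
  obtain ⟨i, -, rfl⟩ := Finset.mem_image.1 (Finset.mem_coe.1 hy)
  have h2 : i ∈ ({j | a j = z} : Finset (Fin k)) := by
    have h3 : i ∈ ({j | a j = a i} : Finset (Fin k)) := by simp
    have hyz' : ({j | a j = a i} : Finset (Fin k)) = ({j | a j = z} : Finset (Fin k)) := hyz
    rwa [hyz'] at h3
  simpa using h2

theorem sum_eq_sum_labelings {k : ℕ} (f : (Fin k → Fin n) → ℂ) :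
    ∑ a, f a = ∑ π : SetPartition k, ∑ a ∈ labelings n π, f a := by
  classical
  rw [← Finset.sum_fiberwise Finset.univ
    (fun a : Fin k → Fin n => Finpartition.ofSetoid (Setoid.ker a))]
  refine Finset.sum_congr rfl fun π _ => Finset.sum_congr ?_ fun _ _ => rfl
  ext a
  rw [labelings, Finset.mem_filter, Finset.mem_filter, Finpartition.ext_iff]
  simp only [Finset.mem_univ, true_and]
  have h : (Finpartition.ofSetoid (Setoid.ker a)).parts =
      Finset.univ.image (fun i => ({j | a j = a i} : Finset (Fin k))) := by
    rw [Finpartition.ofSetoid, Finpartition.ofSetSetoid_parts]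
    refine Finset.image_congr fun i _ => Finset.filter_congr fun j _ => ?_
    exact eq_comm
  rw [h]

/-- The moments of the compressed matrix as a sum over all set partitions. -/
theorem conferenceMoment_eq_sum (S : Matrix (Fin n) (Fin n) ℂ) {k : ℕ} (hk : 0 < k) :
    conferenceMoment S p k = ∑ π : SetPartition k, (p : ℂ) ^ π.parts.card * cyclicSum S π := by
  unfold conferenceMoment cyclicSum
  simp only [trace_pow_eq_sum _ hk, prod_selection]
  rw [bernoulliExpect_sum]
  simp only [bernoulliExpect_subset]
  rw [sum_eq_sum_labelings, Finset.mul_sum]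
  refine Finset.sum_congr rfl fun π _ => ?_
  rw [mul_left_comm, Finset.mul_sum _ _ ((p : ℂ) ^ π.parts.card)]
  congr 1
  exact Finset.sum_congr rfl fun a ha => by rw [card_image_of_mem_labelings ha]

theorem tendsto_conferenceMoment {n : ℕ → ℕ} {S : ∀ N, Matrix (Fin (n N)) (Fin (n N)) ℂ} {s : ℝ}
    (hS : IsScaledConferenceSeq (fun N => ((1 / √(n N : ℝ) : ℝ) : ℂ) • S N) s) (p : ℝ) {k : ℕ}
    (hk : 0 < k) :
    Tendsto (fun N => conferenceMoment (S N) p k) atTop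
      (𝓝 (limitConferenceMoment s p k : ℂ)) := by
  classical
  simp only [conferenceMoment_eq_sum _ hk]
  rw [limitConferenceMoment, Finset.sum_filter, Complex.ofReal_sum]
  refine tendsto_finsetSum _ fun π _ => ?_
  split_ifs with hπ
  · rw [Complex.ofReal_mul, Complex.ofReal_pow]
    convert (tendsto_cyclicSum_of_isNonCrossing π hS hk hπ).2.const_mul _
  · rw [Complex.ofReal_zero, ← mul_zero ((p : ℂ) ^ π.parts.card)]
    exact (tendsto_cyclicSum_of_crossing π hS hk hπ).const_mul _

theorem selection_mul_self (T : Finset (Fin n)) : selection T * selection T = selection T := by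
  rw [selection, Matrix.diagonal_mul_diagonal]
  congr 1
  funext i
  split_ifs <;> simp

/-- Binomial expansion of the compression of `u S + h I`: the projection `P` is a unit for `P S P`. -/
theorem trace_pow_compression (S : Matrix (Fin n) (Fin n) ℂ) (T : Finset (Fin n)) (u h : ℂ)
    {k : ℕ} (hk : 0 < k) :
    ((selection T * (u • S + h • (1 : Matrix (Fin n) (Fin n) ℂ)) * selection T) ^ k).trace =
      h ^ k * (selection T).trace + ∑ j ∈ Finset.Icc 1 k, (k.choose j : ℂ) * u ^ j * h ^ (k - j) *
        ((selection T * S * selection T) ^ j).trace := by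
  set P := selection T with hP
  set X := P * S * P with hX
  have hPP : P * P = P := selection_mul_self T
  have hXP : X * P = X := by rw [hX, Matrix.mul_assoc, hPP]
  have hPX : P * X = X := by rw [hX, ← Matrix.mul_assoc, ← Matrix.mul_assoc, hPP]
  have hPpow : ∀ i, P ^ (i + 1) = P := fun i => by
    induction i with
    | zero => rw [zero_add, pow_one]
    | succ i ih => rw [pow_succ, ih, hPP]
  have hXPpow : ∀ j i, X ^ (j + 1) * P ^ i = X ^ (j + 1) := fun j i => by
    rcases i with _ | i
    · rw [pow_zero, mul_one]
    · rw [hPpow, pow_succ, mul_assoc, hXP]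
  have h1 : P * (u • S + h • (1 : Matrix (Fin n) (Fin n) ℂ)) * P = u • X + h • P := by
    rw [Matrix.mul_add, Matrix.add_mul, Matrix.mul_smul, Matrix.smul_mul, Matrix.mul_smul,
      Matrix.smul_mul, Matrix.mul_one, hPP]
  have hcomm : Commute (u • X) (h • P) := by
    have : Commute X P := hXP.trans hPX.symm
    exact (this.smul_left u).smul_right h
  rw [h1, hcomm.add_pow, Finset.sum_range_succ', Matrix.trace_add, add_comm, Matrix.trace_sum]
  congr 1
  · obtain ⟨k, rfl⟩ := Nat.exists_eq_add_of_le' hk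
    simp [smul_pow, hPpow]
  · rw [Finset.sum_bij (fun j _ => j + 1) (t := Finset.Icc 1 k) (g := fun j => (k.choose j : ℂ) *
      u ^ j * h ^ (k - j) * (X ^ j).trace)]
    · intro j hj
      simp only [Finset.mem_range] at hj
      simp only [Finset.mem_Icc]
      omega
    · intro i _ j _ hij
      omega
    · intro j hj
      simp only [Finset.mem_Icc] at hj
      exact ⟨j - 1, by simp only [Finset.mem_range]; omega, by omega⟩
    · intro j _
      have h2 : ((k.choose (j + 1) : ℕ) : Matrix (Fin n) (Fin n) ℂ) =
          ((k.choose (j + 1) : ℕ) : ℂ) • (1 : Matrix (Fin n) (Fin n) ℂ) := by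
        rw [Matrix.smul_one_eq_diagonal]; rfl
      rw [smul_pow, smul_pow, Matrix.smul_mul, Matrix.mul_smul, hXPpow, h2, Matrix.mul_smul,
        Matrix.mul_one, Matrix.trace_smul, Matrix.trace_smul, Matrix.trace_smul]
      simp only [smul_eq_mul]
      ring

theorem bernoulliExpect_trace_selection :
    bernoulliExpect n p (fun T => (selection T).trace) = n * p := by
  have h : ∀ T : Finset (Fin n), (selection T).trace =
      ∑ i, if ({i} : Finset (Fin n)) ⊆ T then (1 : ℂ) else 0 := fun T => by
    simp [selection, Matrix.trace]
  simp only [h]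
  rw [bernoulliExpect_sum]
  simp only [bernoulliExpect_subset]
  simp

theorem bernoulliExpect_trace_pow (hn : 0 < n) (S : Matrix (Fin n) (Fin n) ℂ) (j : ℕ) :
    1 / (n : ℂ) * bernoulliExpect n p (fun T => ((selection T * S * selection T) ^ j).trace) =
      (√(n : ℝ) : ℂ) ^ j * conferenceMoment S p j := by
  have hn' : (0 : ℝ) < n := by exact_mod_cast hn
  have hpow : (n : ℝ) ^ ((j : ℝ) / 2 + 1) = √n ^ j * n := by
    rw [Real.rpow_add hn', Real.rpow_one, Real.sqrt_eq_rpow, ← Real.rpow_natCast,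
      ← Real.rpow_mul hn'.le]
    congr 2
    ring
  have h1 : (√(n : ℝ) : ℂ) ≠ 0 := by exact_mod_cast (Real.sqrt_pos.2 hn').ne'
  have h2 : (n : ℂ) ≠ 0 := by exact_mod_cast hn.ne'
  unfold conferenceMoment
  rw [hpow]
  push_cast
  field_simp

/-- The moments of the compressed Gram matrix in terms of those of the compressed generalized
conference matrix. -/
theorem frameMoment_eq {m : ℕ} (F : Matrix (Fin m) (Fin n) ℂ) (hn : 2 ≤ n)
    (hx : 0 < ratioParam (aspectRatio m n)) {k : ℕ} (hk : 0 < k) :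
    frameMoment F p k = ((1 / (2 * aspectRatio m n) : ℝ) : ℂ) ^ k * p +
      ∑ j ∈ Finset.Icc 1 k, (k.choose j : ℂ) *
        (((√(((n : ℝ) - 1) / n / ratioParam (aspectRatio m n)))⁻¹ : ℝ) : ℂ) ^ j *
        ((1 / (2 * aspectRatio m n) : ℝ) : ℂ) ^ (k - j) *
        conferenceMoment (conferenceMatrix F) p j := by
  have hn0 : (0 : ℝ) < n := by positivity
  have hn1 : (0 : ℝ) < (n : ℝ) - 1 := by
    have : (2 : ℝ) ≤ n := by exact_mod_cast hn
    linarith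
  have hnc : (n : ℂ) ≠ 0 := by exact_mod_cast hn0.ne'
  set x := ratioParam (aspectRatio m n) with hxdef
  set h : ℂ := ((1 / (2 * aspectRatio m n) : ℝ) : ℂ) with hh
  set c : ℝ := √(((n : ℝ) - 1) / x) with hc
  have hc0 : 0 < c := Real.sqrt_pos.2 (by positivity)
  have hcc : (c : ℂ) ≠ 0 := by exact_mod_cast hc0.ne'
  have hgram : Fᴴ * F = (c : ℂ)⁻¹ • conferenceMatrix F +
      h • (1 : Matrix (Fin n) (Fin n) ℂ) := by
    rw [conferenceMatrix, ← hxdef, ← hc, smul_smul, inv_mul_cancel₀ hcc, one_smul, ← hh,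
      sub_add_cancel]
  have hscale : (√(((n : ℝ) - 1) / n / x))⁻¹ = c⁻¹ * √n := by
    rw [div_right_comm, Real.sqrt_div (by positivity), ← hc, inv_div]
    field_simp
  unfold frameMoment
  rw [bernoulliExpect_mul, hgram]
  simp only [trace_pow_compression _ _ _ _ hk]
  rw [bernoulliExpect_add, bernoulliExpect_sum, bernoulliExpect_mul,
    bernoulliExpect_trace_selection, mul_add, Finset.mul_sum]
  congr 1
  · field_simp
  · refine Finset.sum_congr rfl fun j _ => ?_
    rw [bernoulliExpect_mul, mul_left_comm, bernoulliExpect_trace_pow (by omega), hscale]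
    push_cast
    ring

theorem tendsto_frameMoment {γ : ℝ} (hγ0 : 0 < γ) (hγ1 : γ < 1) {m n : ℕ → ℕ}
    {F : ∀ N : ℕ, Matrix (Fin (m N)) (Fin (n N)) ℂ} (hF : ∀ N, IsUnitNormETF (F N))
    (hn : Tendsto n atTop atTop)
    (hmn : Tendsto (fun N => aspectRatio (m N) (n N)) atTop (𝓝 γ)) (p : ℝ) {k : ℕ} (hk : 0 < k) :
    Tendsto (fun N => frameMoment (F N) p k) atTop (𝓝 (limitFrameMoment γ p k : ℂ)) := by
  have hx := ratioParam_pos hγ0 hγ1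
  have hS := isScaledConferenceSeq hγ0 hγ1 hF hn hmn
  have hxN := (continuousAt_ratioParam hγ0).tendsto.comp hmn
  have h1 : Tendsto (fun N => ((1 / (2 * aspectRatio (m N) (n N)) : ℝ) : ℂ)) atTop
      (𝓝 (((ratioParam γ + 1) / 2 : ℝ) : ℂ)) := by
    refine (Complex.continuous_ofReal.tendsto _).comp ?_
    have e : (ratioParam γ + 1) / 2 = 1 / (2 * γ) := by
      rw [ratioParam]
      field_simp
      ring
    rw [e]
    exact (tendsto_const_nhds (x := (1 : ℝ))).div (hmn.const_mul 2) (by positivity)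
  have h2 : Tendsto (fun N => (((√(((n N : ℝ) - 1) / n N /
      ratioParam (aspectRatio (m N) (n N))))⁻¹ : ℝ) : ℂ)) atTop (𝓝 ((√(ratioParam γ) : ℝ) : ℂ)) := by
    refine (Complex.continuous_ofReal.tendsto _).comp ?_
    have h := (((tendsto_sub_one_div hn).div hxN hx.ne').sqrt).inv₀
      (Real.sqrt_pos.2 (by positivity)).ne'
    rw [one_div, Real.sqrt_inv, inv_inv] at h
    exact h
  have h3 : Tendsto (fun N => ((1 / (2 * aspectRatio (m N) (n N)) : ℝ) : ℂ) ^ k * (p : ℂ) +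
      ∑ j ∈ Finset.Icc 1 k, (k.choose j : ℂ) *
        (((√(((n N : ℝ) - 1) / n N / ratioParam (aspectRatio (m N) (n N))))⁻¹ : ℝ) : ℂ) ^ j *
        ((1 / (2 * aspectRatio (m N) (n N)) : ℝ) : ℂ) ^ (k - j) *
        conferenceMoment (conferenceMatrix (F N)) p j) atTop
      (𝓝 (limitFrameMoment γ p k : ℂ)) := by
    have e : (limitFrameMoment γ p k : ℂ) = (((ratioParam γ + 1) / 2 : ℝ) : ℂ) ^ k * (p : ℂ) +
        ∑ j ∈ Finset.Icc 1 k, (k.choose j : ℂ) * ((√(ratioParam γ) : ℝ) : ℂ) ^ j *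
          (((ratioParam γ + 1) / 2 : ℝ) : ℂ) ^ (k - j) *
          (limitConferenceMoment (diagParam γ) p j : ℂ) := by
      rw [limitFrameMoment]
      push_cast
      rfl
    rw [e]
    refine ((h1.pow k).mul_const _).add (tendsto_finsetSum _ fun j hj => ?_)
    exact (((h2.pow j).const_mul _).mul (h1.pow _)).mul
      (tendsto_conferenceMoment hS p (Finset.mem_Icc.1 hj).1)
  refine h3.congr' ?_
  filter_upwards [hn.eventually_ge_atTop 2, hxN.eventually_const_lt hx] with N hN1 hN2
  exact (frameMoment_eq (F N) hN1 hN2 hk).symm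

end Moments

end ETF

theorem lemma1 (γ : ℝ) (hγ0 : 0 < γ) (hγ1 : γ < 1) (m n : ℕ → ℕ)
    (F : ∀ N : ℕ, Matrix (Fin (m N)) (Fin (n N)) ℂ)
    (hF : ∀ N, ETF.IsUnitNormETF (F N))
    (hn : Tendsto n atTop atTop)
    (hmn : Tendsto (fun N => ETF.aspectRatio (m N) (n N)) atTop (𝓝 γ)) :
    (∀ (k : ℕ), 1 ≤ k → ∀ π : ETF.SetPartition k, ETF.IsNonCrossing π →
      ∀ D : Finpartition (Finset.univ : Finset (Fin k)),
        (∀ C ∈ D.parts, ETF.IsSimpleCycle (ETF.partitionGraph π) C) →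
        Tendsto (fun N => ETF.cyclicSum (ETF.conferenceMatrix (F N)) π) atTop
          (𝓝 ((∏ C ∈ D.parts, ETF.cycleWeight (ETF.diagParam γ) C.card : ℝ) : ℂ))) ∧
    (∀ p : ℝ, 0 ≤ p → p ≤ 1 → ∀ k : ℕ, 1 ≤ k →
      Tendsto (fun N => ETF.conferenceMoment (ETF.conferenceMatrix (F N)) p k) atTop
          (𝓝 (ETF.limitConferenceMoment (ETF.diagParam γ) p k : ℂ)) ∧
      Tendsto (fun N => ETF.frameMoment (F N) p k) atTop
          (𝓝 (ETF.limitFrameMoment γ p k : ℂ))) := by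
  have hS := ETF.isScaledConferenceSeq hγ0 hγ1 hF hn hmn
  refine ⟨fun k hk π hπ D hD => ?_, fun p _ _ k hk =>
    ⟨ETF.tendsto_conferenceMoment hS p hk, ETF.tendsto_frameMoment hγ0 hγ1 hF hn hmn p hk⟩⟩
  obtain ⟨hdisj, hlim⟩ := ETF.tendsto_cyclicSum_of_isNonCrossing π hS hk hπ
  rw [ETF.parts_eq_simpleCycles π hdisj D hD]
  exact hlim
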